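/- **Setting.** Let $\mathcal T=\{\mathcal T_i\}_{i=1}^N$ with $\mathcal T_i\in\mathbb R^{1\times r_1r_2}$ be fixed (frozen templates). For scalers $\mathcal S=\{\mathcal S_i\}_{i=1}^N$, $\mathcal S_i\in\mathbb R^{L\times B}$, put $\mathcal T\otimes\mathcal S=\sum_{i=1}^N\mathcal T_i\otimes\mathcal S_i\in\mathbb R^{L\times P}$ with $P=r_1r_2B$ (Kronecker products), and let $\|\mathcal T\|_F,\|\mathcal S\|_F$ be the root of the sum of all squared entries of the family. Given a network $f(x;\mathcal W)\in\mathbb R^q$ with weights $\mathcal W\in\mathbb R^{L\times P}$ and $C_S\ge 0$, let $$\mathcal H_{\mathrm{WeiT}}=\{f(\,\cdot\,;\mathcal T\otimes\mathcal S)\;:\;\|\mathcal S\|_F\le C_S\}.$$ Let $\ell(u,y)$ be a measurable loss, and let $(x_1,y_1),\dots,(x_m,y_m)$, $m\ge1$, be i.i.d. samples from a probability law $\mu$. Put $$R(h)=\mathbb E_{(x,y)\sim\mu}\,\ell(h(x),y),\qquad \hat R(h)=\frac1m\sum_{i=1}^m\ell(h(x_i),y_i),$$ $$\hat{\mathfrak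 R}_m(\mathcal H_{\mathrm{WeiT}})=\frac1{2^m}\sum_{\sigma\in\{-1,1\}^m}\ \sup_{h\in\mathcal H_{\mathrm{WeiT}}}\frac1m\sum_{i=1}^m\sigma_i\,\ell(h(x_i),y_i).$$ Assume that, for $\mu$-almost every $(x,y)$, $\ell(h(x),y)\in[0,1]$ for all $h\in\mathcal H_{\mathrm{WeiT}}$. **Theorem (generalization bound for scalable initialization).** (1) Let $f$ be any network that is measurable in $x$ and continuous in $\mathcal W$, let $\ell$ be continuous in the network output, and let $0<\delta<1$. With probability at least $1-\delta$, for all $h\in\mathcal H_{\mathrm{WeiT}}$, $$R(h)\le\hat R(h)+2\,\hat{\mathfrak R}_m(\mathcal H_{\mathrm{WeiT}})+3\sqrt{\frac{\log(2/\delta)}{2m}} .$$ (2) Let $f(x;\mathcal W)$ be a Transformer with inputs $x\in\mathbb R^p$ and $L$ layers, where row $l$ of $\mathcal W$ lists, in any fixed order, the entries of the matrices $W_q^i,W_k^i,W_v^i\in\mathbb R^{D\times d}$ $(i\le H)$, $W_o\in\mathbb R^{Hd\times D}$, $W_{\mathrm{in}}\in\mathbb R^{D\times D'}$, $W_{\mathrm{out}}\in\mathbb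 R^{D'\times D}$ of layer $l$, so that $P=D(4Hd+2D')$. A layer consists of the block $\mathrm{MSA}(Z)=\mathrm{concat}(A_1,\dots,A_H)W_o$ with $A_i=\mathrm{softmax}\big(ZW_q^i(ZW_k^i)^\top/\sqrt d\big)ZW_v^i$, followed by the block $\mathrm{FFN}(Z)=\phi(ZW_{\mathrm{in}}+b_1)W_{\mathrm{out}}+b_2$. The activation $\phi$ is Lipschitz (e.g. GELU). Everything other than $\mathcal W$ is fixed: the biases, a Lipschitz embedding of the input and a Lipschitz output map, and in each layer a skip coefficient $s\in\mathbb R$ and Lipschitz maps (e.g. identities or layer normalizations) such that each block $G$ acts as $Z\mapsto g_{\mathrm{post}}\big(sZ+G(g_{\mathrm{pre}}(Z))\big)$. The case $s=0$ with all maps $g$ the identity is allowed. For every such Transformer and all $\rho,\Lambda>0$ there is a constant $K>0$, depending only on the Transformer and on $\rho,\Lambda$, with the following property. Let $\mathcal T$ and $C_S$ satisfy $C_S\|\mathcal T\|_F\le\Lambda$. Let $R\le\Lambda$, and suppose that either $R\ge\rho$, or all biases are zero and $\phi$, the embedding and all maps $g_{\mathrm{pre}},g_{\mathrm{post}}$ send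 $0$ to $0$. Let $\ell(\cdot,y)$ be $L_\ell$-Lipschitz for every $y$, with $L_\ell\ge0$. Then, for all $m\ge1$, $$2\,\hat{\mathfrak R}_m(\mathcal H_{\mathrm{WeiT}})\le K\,\frac{L_\ell\,R\,C_S\,\|\mathcal T\|_F}{\sqrt m}$$ on every sample with $\|x_i\|\le R$ for all $i$ (this part does not need $\ell\in[0,1]$). If moreover $\|x\|\le R$ almost surely, then for every $0<\delta<1$, with probability at least $1-\delta$, for all $h\in\mathcal H_{\mathrm{WeiT}}$, $$R(h)\le\hat R(h)+K\,\frac{L_\ell\,R\,C_S\,\|\mathcal T\|_F}{\sqrt m}+3\sqrt{\frac{\log(2/\delta)}{2m}} .$$ -/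

import Mathlib

open MeasureTheory
open scoped Kronecker Matrix

noncomputable section

namespace WeiT

/-! ### Risks and empirical Rademacher complexity -/

section Learning

variable {X Y F : Type*}

/-- The expected true risk of the predictor `h` for the loss `loss` under the law `μ` of `(x, y)`. -/
def risk [MeasurableSpace X] [MeasurableSpace Y] (μ : Measure (X × Y)) (loss : F → Y → ℝ)
    (h : X → F) : ℝ :=
  ∫ z, loss (h z.1) z.2 ∂μ

/-- The empirical risk of `h` on the sample `z`. -/
def empRisk {m : ℕ} (z : Fin m → X × Y) (loss : F → Y → ℝ) (h : X → F) : ℝ :=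
  (1 / (m : ℝ)) * ∑ i, loss (h (z i).1) (z i).2

/-- The empirical Rademacher complexity, on the sample `z`, of a hypothesis space `H` seen through
the loss: the average over all sign vectors `σ ∈ {-1, 1}^m` of
`sup_{h ∈ H} (1/m) ∑ i, σ i * loss (h (x i)) (y i)`. -/
def rademacher {m : ℕ} (H : Set (X → F)) (loss : F → Y → ℝ) (z : Fin m → X × Y) : ℝ :=
  (1 / (2 : ℝ) ^ m) * ∑ σ : Fin m → ℤˣ,
    ⨆ h : H, (1 / (m : ℝ)) * ∑ i, ((σ i : ℤ) : ℝ) * loss (h.1 (z i).1) (z i).2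

end Learning

/-! ### Templates, scalers and the constrained hypothesis space -/

/-- Frobenius norm of a finite family of matrices: root of the sum of all squared entries. -/
def famNorm {N a b : ℕ} (M : Fin N → Matrix (Fin a) (Fin b) ℝ) : ℝ :=
  Real.sqrt (∑ i, ∑ j, ∑ k, M i j k ^ 2)

/-- `T ⊗ S = ∑ i, T i ⊗ S i`, an `L × (A * B)` matrix; column `a * B + b` is the pair `(a, b)`. -/
def kron {N L A B : ℕ} (T : Fin N → Matrix (Fin 1) (Fin A) ℝ)
    (S : Fin N → Matrix (Fin L) (Fin B) ℝ) : Matrix (Fin L) (Fin (A * B)) ℝ :=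
  Matrix.reindex (Equiv.uniqueProd (Fin L) (Fin 1)) finProdFinEquiv (∑ i, T i ⊗ₖ S i)

/-- The hypothesis space `{ f(·; T ⊗ S) | ‖S‖_F ≤ C }` with frozen templates `T`. -/
def hypothesisSpace {X F : Type*} {N L A B : ℕ} (f : X → Matrix (Fin L) (Fin (A * B)) ℝ → F)
    (T : Fin N → Matrix (Fin 1) (Fin A) ℝ) (C : ℝ) : Set (X → F) :=
  {h | ∃ S : Fin N → Matrix (Fin L) (Fin B) ℝ, famNorm S ≤ C ∧ h = fun x => f x (kron T S)}

/-! ### Transformers -/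

section Transformer

attribute [local instance] Matrix.frobeniusNormedAddCommGroup

/-- The primary weight matrices of one layer: `H` heads of dimension `d`, embedding dimension `D`,
hidden dimension `D'`. -/
structure LayerWeights (H d D D' : ℕ) where
  Wq : Fin H → Matrix (Fin D) (Fin d) ℝ
  Wk : Fin H → Matrix (Fin D) (Fin d) ℝ
  Wv : Fin H → Matrix (Fin D) (Fin d) ℝ
  Wo : Matrix (Fin H × Fin d) (Fin D) ℝ
  Win : Matrix (Fin D) (Fin D') ℝ
  Wout : Matrix (Fin D') (Fin D) ℝ

/-- Positions of the scalar entries of the weight matrices of one layer; there are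
`D * (4 * H * d + 2 * D')` of them. The components are `Wq`, `Wk`, `Wv`, `Wo`, `Win`, `Wout`. -/
abbrev LayerEntry (H d D D' : ℕ) : Type :=
  (Fin H × Fin D × Fin d) ⊕ (Fin H × Fin D × Fin d) ⊕ (Fin H × Fin D × Fin d) ⊕
    ((Fin H × Fin d) × Fin D) ⊕ (Fin D × Fin D') ⊕ (Fin D' × Fin D)

/-- The weight matrices of a layer, read off from the vector of their entries. -/
def LayerWeights.ofEntries {H d D D' : ℕ} (w : LayerEntry H d D D' → ℝ) :
    LayerWeights H d D D' where
  Wq h := Matrix.of fun i j => w (.inl (h, i, j))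
  Wk h := Matrix.of fun i j => w (.inr (.inl (h, i, j)))
  Wv h := Matrix.of fun i j => w (.inr (.inr (.inl (h, i, j))))
  Wo := Matrix.of fun i j => w (.inr (.inr (.inr (.inl (i, j)))))
  Win := Matrix.of fun i j => w (.inr (.inr (.inr (.inr (.inl (i, j))))))
  Wout := Matrix.of fun i j => w (.inr (.inr (.inr (.inr (.inr (i, j))))))

/-- Row-wise softmax. -/
def softmax {n k : ℕ} (M : Matrix (Fin n) (Fin k) ℝ) : Matrix (Fin n) (Fin k) ℝ :=
  Matrix.of fun i j => Real.exp (M i j) / ∑ j', Real.exp (M i j')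

/-- One attention head, `softmax (Q Kᵀ / √d) V`, with `Q = Z Wq`, `K = Z Wk`, `V = Z Wv`. -/
def head {n d D : ℕ} (Wq Wk Wv : Matrix (Fin D) (Fin d) ℝ) (Z : Matrix (Fin n) (Fin D) ℝ) :
    Matrix (Fin n) (Fin d) ℝ :=
  softmax ((1 / Real.sqrt d) • ((Z * Wq) * (Z * Wk)ᵀ)) * (Z * Wv)

/-- Multi-head self-attention: concatenated heads, projected by `Wo`. -/
def msa {n H d D D' : ℕ} (w : LayerWeights H d D D') (Z : Matrix (Fin n) (Fin D) ℝ) :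
    Matrix (Fin n) (Fin D) ℝ :=
  (Matrix.of fun i (c : Fin H × Fin d) => head (w.Wq c.1) (w.Wk c.1) (w.Wv c.1) Z i c.2) * w.Wo

/-- Feed-forward network `act (Z Win + b₁) Wout + b₂`, the biases being added to every row. -/
def ffn {n H d D D' : ℕ} (act : ℝ → ℝ) (b₁ : Fin D' → ℝ) (b₂ : Fin D → ℝ)
    (w : LayerWeights H d D D') (Z : Matrix (Fin n) (Fin D) ℝ) : Matrix (Fin n) (Fin D) ℝ :=
  ((Z * w.Win + Matrix.of fun _ j => b₁ j).map act) * w.Wout + Matrix.of fun _ j => b₂ j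

/-- A map of token matrices that is Lipschitz for the Frobenius norm. -/
def FrobLipschitz {n D : ℕ} (g : Matrix (Fin n) (Fin D) ℝ → Matrix (Fin n) (Fin D) ℝ) : Prop :=
  ∃ K, LipschitzWith K g

/-- The parts of a layer that do not belong to the primary weight matrices and stay fixed:
biases, the coefficient of the skip connections (`0`: none, `1`: the usual residual connection),
and Lipschitz maps before and after the two blocks (the identity, or layer normalizations). -/
structure FrozenLayer (n D D' : ℕ) where
  b₁ : Fin D' → ℝ
  b₂ : Fin D → ℝ
  skip : ℝ
  msaPre : Matrix (Fin n) (Fin D) ℝ → Matrix (Fin n) (Fin D) ℝ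
  msaPost : Matrix (Fin n) (Fin D) ℝ → Matrix (Fin n) (Fin D) ℝ
  ffnPre : Matrix (Fin n) (Fin D) ℝ → Matrix (Fin n) (Fin D) ℝ
  ffnPost : Matrix (Fin n) (Fin D) ℝ → Matrix (Fin n) (Fin D) ℝ
  msaPre_lip : FrobLipschitz msaPre
  msaPost_lip : FrobLipschitz msaPost
  ffnPre_lip : FrobLipschitz ffnPre
  ffnPost_lip : FrobLipschitz ffnPost

/-- The attention block followed by the feed-forward block. -/
def FrozenLayer.run {n H d D D' : ℕ} (F : FrozenLayer n D D') (act : ℝ → ℝ)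
    (w : LayerWeights H d D D') (Z : Matrix (Fin n) (Fin D) ℝ) : Matrix (Fin n) (Fin D) ℝ :=
  let Z₁ := F.msaPost (F.skip • Z + msa w (F.msaPre Z))
  F.ffnPost (F.skip • Z₁ + ffn act F.b₁ F.b₂ w (F.ffnPre Z₁))

/-- A target Transformer with everything but its primary weight matrices fixed: inputs in `ℝ^p`,
`n` tokens, `L` layers, outputs in `ℝ^q`; a Lipschitz embedding (patch and position embedding), a
Lipschitz activation (for instance GELU or ReLU) and a Lipschitz output map. -/
structure Transformer (p n L H d D D' q : ℕ) where
  act : ℝ → ℝ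
  act_lip : ∃ K, LipschitzWith K act
  embed : EuclideanSpace ℝ (Fin p) → Matrix (Fin n) (Fin D) ℝ
  embed_lip : ∃ K, LipschitzWith K embed
  layer : Fin L → FrozenLayer n D D'
  out : Matrix (Fin n) (Fin D) ℝ → EuclideanSpace ℝ (Fin q)
  out_lip : ∃ K, LipschitzWith K out

variable {p n L H d D D' q : ℕ}

/-- The output `f(x; W)`. Row `l` of the unified matrix `W` holds the entries of the weight matrices
of layer `l`, listed in the order `e`. -/
def Transformer.eval {P : ℕ} (M : Transformer p n L H d D D' q) (e : LayerEntry H d D D' ≃ Fin P)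
    (x : EuclideanSpace ℝ (Fin p)) (W : Matrix (Fin L) (Fin P) ℝ) : EuclideanSpace ℝ (Fin q) :=
  M.out (Fin.foldl L
    (fun Z l => (M.layer l).run M.act (LayerWeights.ofEntries fun j => W l (e j)) Z) (M.embed x))

/-- No frozen part up to the output map has an offset: biases vanish, and the activation, the
embedding and the maps around the blocks send `0` to `0`. -/
structure Transformer.OffsetFree (M : Transformer p n L H d D D' q) : Prop where
  act : M.act 0 = 0
  embed : M.embed 0 = 0
  b₁ : ∀ l, (M.layer l).b₁ = 0
  b₂ : ∀ l, (M.layer l).b₂ = 0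
  msaPre : ∀ l, (M.layer l).msaPre 0 = 0
  msaPost : ∀ l, (M.layer l).msaPost 0 = 0
  ffnPre : ∀ l, (M.layer l).ffnPre 0 = 0
  ffnPost : ∀ l, (M.layer l).ffnPost 0 = 0

end Transformer

end WeiT

end

/-! The uniform bound is the classical Rademacher argument. Let the deviation be the supremum over
hypotheses of true risk minus empirical risk. Changing one sample point moves both the deviation and
the empirical Rademacher complexity by at most `1 / m`, so McDiarmid's inequality
(`measureReal_pi_ge_le`) keeps each within `s = √(log (2/δ) / (2m))` of its mean on the relevant
side, with failure probability `δ / 2` each. Symmetrization (`integral_deviation_le`) bounds the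
mean deviation by twice the mean complexity; the three errors `s + 2s` add up to the last term.
Suprema are taken over a dense sequence of scalers, which settles measurability, and continuity in
the weights recovers all hypotheses (`generalization_bound`).

The complexity of Transformers is bounded by chaining in weight space. By Cauchy–Schwarz every entry
of `T ⊗ S` is at most `‖T‖_F ‖S‖_F` (`abs_kron_le`), so the weights lie in a cube of fixed dimension
and half-side `C_S ‖T‖_F`. On a cube, a Rademacher process whose increments are Lipschitz with
constant `A` has expected supremum of order `A r √m` (`average_signs_iSup_lipschitz_le`).

It remains to see that the output is Lipschitz in the weights with constant proportional to the
input size `R` (`Transformer.exists_lipschitz_weights`). The class of `Tame` families, bounded and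
Lipschitz at a common scale, is stable under every operation of a layer. Attention scores are
quadratic in the tokens, but the softmax only needs them bounded, so a head stays linear in the
scale. Frozen offsets do not scale with the input; they are harmless because either `R` is bounded
below by `ρ` or they vanish. -/

namespace WeiT

/-! ### McDiarmid's inequality through exponential moments. -/

section BoundedDifferences

variable {Z : Type*} [MeasurableSpace Z]

/-- A bounded measurable real function is integrable for a finite measure. -/
theorem integrable_of_measurable_of_abs_le {Ω : Type*} [MeasurableSpace Ω] {ν : Measure Ω}
    [IsFiniteMeasure ν] {f : Ω → ℝ} (hf : Measurable f) {C : ℝ} (hC : ∀ x, |f x| ≤ C) :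
    Integrable f ν :=
  Integrable.of_bound hf.aestronglyMeasurable C (Filter.Eventually.of_forall hC)

/-- Hoeffding's lemma for a function whose oscillation is at most `c`. -/
theorem integral_exp_centered_le (μ : Measure Z) [IsProbabilityMeasure μ] {g : Z → ℝ}
    (hg : Measurable g) {c : ℝ} (hc : ∀ a b, g a - g b ≤ c) (t : ℝ) :
    ∫ a, Real.exp (t * (g a - ∫ b, g b ∂μ)) ∂μ ≤ Real.exp (c ^ 2 * t ^ 2 / 8) := by
  have : Nonempty Z := μ.nonempty_of_neZero
  let a₀ : Z := Classical.arbitrary Z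
  have hc0 : 0 ≤ c := by simpa using hc a₀ a₀
  have hbdd : BddBelow (Set.range g) := by
    refine ⟨g a₀ - c, ?_⟩
    rintro _ ⟨a, rfl⟩
    linarith [hc a₀ a]
  -- Bounded oscillation confines `g` to an interval of length `c` starting at its infimum, as
  -- Hoeffding's lemma requires.
  have hmem : ∀ a, g a ∈ Set.Icc (⨅ b, g b) ((⨅ b, g b) + c) := fun a =>
    ⟨ciInf_le hbdd a, by
      have : g a - c ≤ ⨅ b, g b := le_ciInf fun b => by linarith [hc a b]
      linarith⟩
  have h := (ProbabilityTheory.hasSubgaussianMGF_of_mem_Icc (μ := μ) hg.aemeasurable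
    (Filter.Eventually.of_forall hmem)).mgf_le t
  refine h.trans (le_of_eq ?_)
  congr 1
  simp [abs_of_nonneg hc0]
  ring

/-- The exponential moment bound behind the bounded difference inequality. -/
theorem integral_exp_centered_pi_le (μ : Measure Z) [IsProbabilityMeasure μ] (c t : ℝ) (m : ℕ)
    (F : (Fin m → Z) → ℝ) (hF : Measurable F) (hb : ∃ M, ∀ z, |F z| ≤ M)
    (hc : ∀ z k a, F (Function.update z k a) - F z ≤ c) :
    ∫ z, Real.exp (t * (F z - ∫ w, F w ∂Measure.pi fun _ => μ)) ∂(Measure.pi fun _ => μ) ≤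
      Real.exp (m * (c ^ 2 * t ^ 2 / 8)) := by
  induction m with
  | zero =>
    have h : ∀ z, F z = F default := fun z => congrArg F (Subsingleton.elim _ _)
    simp [h]
  | succ m ih =>
    obtain ⟨M, hM⟩ := hb
    have hcons : Measurable fun p : Z × (Fin m → Z) => (Fin.cons p.1 p.2 : Fin (m + 1) → Z) := by
      refine measurable_pi_iff.2 fun i => ?_
      refine Fin.cases ?_ (fun j => ?_) i
      · simpa using measurable_fst
      · exact (measurable_pi_apply j).comp measurable_snd
    have key : ∀ G : (Fin (m + 1) → Z) → ℝ, Measurable G → (∃ C, ∀ z, |G z| ≤ C) →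
        ∫ z, G z ∂(Measure.pi fun _ => μ) =
          ∫ z, ∫ a, G (Fin.cons a z) ∂μ ∂(Measure.pi fun _ : Fin m => μ) := by
      rintro G hG ⟨C, hC⟩
      have h := ((measurePreserving_piFinSuccAbove (fun _ : Fin (m + 1) => μ) 0).symm).integral_comp'
        (g := G)
      rw [← h, integral_prod_symm]
      · simp [MeasurableEquiv.piFinSuccAbove_symm_apply, Fin.insertNthEquiv]
      · exact integrable_of_measurable_of_abs_le
          (hG.comp (MeasurableEquiv.measurable _)) (fun x => hC _)
    -- Averaging out coordinate `0` keeps the bound `M` and the difference bound `c`, so the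
    -- induction hypothesis applies to `F₁`.
    set F₁ : (Fin m → Z) → ℝ := fun z => ∫ a, F (Fin.cons a z) ∂μ with hF₁
    have hFc : Measurable fun p : Z × (Fin m → Z) => F (Fin.cons p.1 p.2) := hF.comp hcons
    have hFa : ∀ z : Fin m → Z, Measurable fun a => F (Fin.cons a z) := fun z =>
      hFc.comp (measurable_id.prodMk measurable_const)
    have hI : ∀ z : Fin m → Z, Integrable (fun a => F (Fin.cons a z)) μ := fun z =>
      integrable_of_measurable_of_abs_le (hFa z) (fun a => hM _)
    have hF₁m : Measurable F₁ :=
      (hFc.stronglyMeasurable.integral_prod_left' (μ := μ)).measurable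
    have hF₁b : ∀ z, |F₁ z| ≤ M := fun z => by
      have := norm_integral_le_of_norm_le_const (μ := μ) (f := fun a => F (Fin.cons a z))
        (Filter.Eventually.of_forall fun a => hM _)
      simpa using this
    have hF₁c : ∀ z k a, F₁ (Function.update z k a) - F₁ z ≤ c := fun z k a => by
      rw [hF₁, ← integral_sub (hI _) (hI _)]
      refine (integral_mono ((hI _).sub (hI _)) (integrable_const c) fun b => ?_).trans (by simp)
      have := hc (Fin.cons b z) k.succ a
      rwa [← Fin.cons_update] at this
    have hmean : ∫ w, F w ∂(Measure.pi fun _ => μ) = ∫ z, F₁ z ∂(Measure.pi fun _ => μ) :=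
      key F hF ⟨M, hM⟩
    rw [hmean]
    set E := ∫ z, F₁ z ∂(Measure.pi fun _ => μ)
    have hEb : ∀ x, |x| ≤ M → |Real.exp (t * (x - E))| ≤ Real.exp (|t| * (M + |E|)) := by
      intro x hx
      rw [abs_of_pos (Real.exp_pos _), Real.exp_le_exp]
      refine (le_abs_self _).trans ?_
      rw [abs_mul]
      exact mul_le_mul_of_nonneg_left ((abs_sub _ _).trans (by linarith)) (abs_nonneg t)
    rw [key (fun z => Real.exp (t * (F z - E))) (by fun_prop) ⟨_, fun z => hEb _ (hM z)⟩]
    have hinner : ∀ z : Fin m → Z, ∫ a, Real.exp (t * (F (Fin.cons a z) - E)) ∂μ ≤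
        Real.exp (c ^ 2 * t ^ 2 / 8) * Real.exp (t * (F₁ z - E)) := fun z => by
      have h := integral_exp_centered_le μ (hFa z) (c := c) (fun a b => by
        have := hc (Fin.cons b z) 0 a
        rwa [Fin.update_cons_zero] at this) t
      -- Martingale splitting: the fluctuation of coordinate `0` about its conditional mean `F₁ z`,
      -- handled by Hoeffding's lemma, times the fluctuation of `F₁` about `E`.
      have heq : ∀ a, Real.exp (t * (F (Fin.cons a z) - E)) =
          Real.exp (t * (F (Fin.cons a z) - F₁ z)) * Real.exp (t * (F₁ z - E)) := fun a => by
        rw [← Real.exp_add]; ring_nf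
      simp_rw [heq]
      rw [integral_mul_const]
      exact mul_le_mul_of_nonneg_right h (Real.exp_pos _).le
    have hJ : Measurable fun z : Fin m → Z => ∫ a, Real.exp (t * (F (Fin.cons a z) - E)) ∂μ :=
      (StronglyMeasurable.integral_prod_left' (μ := μ)
        (f := fun p : Z × (Fin m → Z) => Real.exp (t * (F (Fin.cons p.1 p.2) - E)))
        (by fun_prop : Measurable _).stronglyMeasurable).measurable
    calc _ ≤ ∫ z, Real.exp (c ^ 2 * t ^ 2 / 8) * Real.exp (t * (F₁ z - E))
          ∂(Measure.pi fun _ : Fin m => μ) := by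
          refine integral_mono_of_nonneg (Filter.Eventually.of_forall fun z =>
            integral_nonneg fun a => (Real.exp_pos _).le) ?_ (Filter.Eventually.of_forall hinner)
          exact (integrable_of_measurable_of_abs_le (by fun_prop)
            fun z => hEb _ (hF₁b z)).const_mul _
      _ ≤ Real.exp (c ^ 2 * t ^ 2 / 8) * Real.exp (m * (c ^ 2 * t ^ 2 / 8)) := by
          rw [integral_const_mul]
          exact mul_le_mul_of_nonneg_left (ih F₁ hF₁m ⟨M, hF₁b⟩ hF₁c) (Real.exp_pos _).le
      _ = _ := by
          rw [← Real.exp_add]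
          push_cast
          ring_nf

/-- McDiarmid's bounded difference inequality for `m` i.i.d. variables, differences `1 / m`. -/
theorem measureReal_pi_ge_le (μ : Measure Z) [IsProbabilityMeasure μ] {m : ℕ} (hm : 0 < m)
    (F : (Fin m → Z) → ℝ) (hF : Measurable F) (hb : ∃ M, ∀ z, |F z| ≤ M)
    (hc : ∀ z k a, F (Function.update z k a) - F z ≤ 1 / m) {ε : ℝ} (hε : 0 ≤ ε) :
    (Measure.pi fun _ : Fin m => μ).real {z | ∫ w, F w ∂(Measure.pi fun _ => μ) + ε ≤ F z} ≤
      Real.exp (-(2 * m * ε ^ 2)) := by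
  have hm' : (0 : ℝ) < m := by exact_mod_cast hm
  set E := ∫ w, F w ∂(Measure.pi fun _ : Fin m => μ)
  -- Chernoff bound: `t = 4 m ε` minimizes `t² / (8m) - t ε`, with value `-2 m ε²`.
  have h1 := ProbabilityTheory.measure_ge_le_exp_mul_mgf
    (μ := Measure.pi fun _ : Fin m => μ) (X := fun z => F z - E) (t := 4 * m * ε) ε (by positivity)
    (by
      obtain ⟨M, hM⟩ := hb
      refine integrable_of_measurable_of_abs_le (C := Real.exp ((4 * m * ε) * (M + |E|)))
        (by fun_prop) fun z => ?_
      rw [abs_of_pos (Real.exp_pos _), Real.exp_le_exp]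
      refine mul_le_mul_of_nonneg_left ?_ (by positivity)
      linarith [le_abs_self (F z), hM z, neg_abs_le E])
  have h2 := integral_exp_centered_pi_le μ (1 / m) (4 * m * ε) m F hF hb hc
  have hset : {z | E + ε ≤ F z} = {z | ε ≤ F z - E} := by
    ext z; simp only [Set.mem_ofPred_eq]; constructor <;> intro h <;> linarith
  rw [hset]
  refine h1.trans ((mul_le_mul_of_nonneg_left h2 (Real.exp_pos _).le).trans (le_of_eq ?_))
  rw [← Real.exp_add]
  congr 1
  field_simp
  ring

end BoundedDifferences

/-! ### Symmetrization and the uniform bound for countable families. -/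

section UniformBound

variable {Z ι : Type*}

/-- The signed empirical average `(1/m) ∑ k, σ k * g (z k)`. -/
noncomputable def signedAvg {m : ℕ} (σ : Fin m → ℤˣ) (g : Z → ℝ) (z : Fin m → Z) : ℝ :=
  (1 / (m : ℝ)) * ∑ k, ((σ k : ℤ) : ℝ) * g (z k)

/-- The empirical Rademacher complexity of an indexed family of functions. -/
noncomputable def familyRademacher {m : ℕ} (g : ι → Z → ℝ) (z : Fin m → Z) : ℝ :=
  (1 / (2 : ℝ) ^ m) * ∑ σ : Fin m → ℤˣ, ⨆ i, signedAvg σ (g i) z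

theorem abs_unit_mul (u : ℤˣ) (x : ℝ) : |((u : ℤ) : ℝ) * x| = |x| := by
  rcases Int.units_eq_one_or u with h | h <;> simp [h]

theorem abs_average_le {m : ℕ} (hm : 0 < m) {a : Fin m → ℝ} {C : ℝ} (h : ∀ k, |a k| ≤ C) :
    |(1 / (m : ℝ)) * ∑ k, a k| ≤ C := by
  have hm' : (0 : ℝ) < m := by exact_mod_cast hm
  rw [abs_mul, abs_of_pos (by positivity), one_div, inv_mul_le_iff₀ hm']
  refine (Finset.abs_sum_le_sum_abs _ _).trans ?_
  simpa using Finset.sum_le_sum fun k (_ : k ∈ Finset.univ) => h k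

theorem sum_update_sub_le {m : ℕ} (hm : 0 < m) (a : Fin m → Z → ℝ) (z : Fin m → Z) (k : Fin m)
    (w : Z) (h : a k w - a k (z k) ≤ 1) :
    (1 / (m : ℝ)) * ∑ j, a j (Function.update z k w j) ≤
      (1 / (m : ℝ)) * ∑ j, a j (z j) + 1 / m := by
  have hm' : (0 : ℝ) < m := by exact_mod_cast hm
  have hsum : ∑ j, a j (Function.update z k w j) = ∑ j, a j (z j) + (a k w - a k (z k)) := by
    rw [← Finset.add_sum_erase _ _ (Finset.mem_univ k),
      ← Finset.add_sum_erase Finset.univ (fun j => a j (z j)) (Finset.mem_univ k),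
      Function.update_self, Finset.sum_congr rfl fun j hj => by
        rw [Function.update_of_ne (Finset.ne_of_mem_erase hj)]]
    ring
  rw [hsum, mul_add]
  gcongr
  exact mul_le_of_le_one_right (by positivity) h

theorem abs_ciSup_le [Nonempty ι] {a : ι → ℝ} {C : ℝ} (h : ∀ i, |a i| ≤ C) : |⨆ i, a i| ≤ C := by
  have hb : BddAbove (Set.range a) := ⟨C, by rintro _ ⟨i, rfl⟩; exact (le_abs_self _).trans (h i)⟩
  refine abs_le.2 ⟨?_, ciSup_le fun i => (le_abs_self _).trans (h i)⟩
  exact (neg_le_of_abs_le (h (Classical.arbitrary ι))).trans (le_ciSup hb _)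

theorem ciSup_le_ciSup_add [Nonempty ι] {a b : ι → ℝ} {C c : ℝ} (hb : ∀ i, |b i| ≤ C)
    (h : ∀ i, a i ≤ b i + c) : ⨆ i, a i ≤ (⨆ i, b i) + c :=
  ciSup_le fun i => (h i).trans <| by
    gcongr
    exact le_ciSup (f := b) ⟨C, by rintro _ ⟨i, rfl⟩; exact (le_abs_self _).trans (hb i)⟩ i

theorem le_ciSup_of_abs_le {a : ι → ℝ} {C : ℝ} (h : ∀ i, |a i| ≤ C) (i : ι) : a i ≤ ⨆ i, a i :=
  le_ciSup (f := a) ⟨C, by rintro _ ⟨i, rfl⟩; exact (le_abs_self _).trans (h i)⟩ i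

theorem abs_signedAvg_le {m : ℕ} (hm : 0 < m) (σ : Fin m → ℤˣ) {g : Z → ℝ}
    (hg : ∀ z, g z ∈ Set.Icc (0 : ℝ) 1) (z : Fin m → Z) : |signedAvg σ g z| ≤ 1 :=
  abs_average_le hm fun k => by
    rw [abs_unit_mul, abs_of_nonneg (hg _).1]; exact (hg _).2

theorem average_signs_le {m : ℕ} {a b : (Fin m → ℤˣ) → ℝ} (h : ∀ σ, a σ ≤ b σ) :
    (1 / (2 : ℝ) ^ m) * ∑ σ, a σ ≤ (1 / (2 : ℝ) ^ m) * ∑ σ, b σ := by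
  gcongr with σ
  exact h σ

theorem average_signs_const (m : ℕ) (c : ℝ) :
    (1 / (2 : ℝ) ^ m) * ∑ _σ : Fin m → ℤˣ, c = c := by
  simp

theorem abs_familyRademacher_le [Nonempty ι] {m : ℕ} (hm : 0 < m) {g : ι → Z → ℝ}
    (hg : ∀ i z, g i z ∈ Set.Icc (0 : ℝ) 1) (z : Fin m → Z) : |familyRademacher g z| ≤ 1 := by
  have h : ∀ σ, |⨆ i, signedAvg σ (g i) z| ≤ 1 := fun σ =>
    abs_ciSup_le fun i => abs_signedAvg_le hm σ (hg i) z
  refine abs_le.2 ⟨?_, ?_⟩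
  · rw [← average_signs_const m (-1)]
    exact average_signs_le fun σ => (abs_le.1 (h σ)).1
  · rw [← average_signs_const m 1]
    exact average_signs_le fun σ => (abs_le.1 (h σ)).2

/-- One sample point enters each signed average with weight `1 / m` and a value in `[0, 1]`; suprema
and sign averages preserve the resulting bound. -/
theorem familyRademacher_sub_update_le [Nonempty ι] {m : ℕ} (hm : 0 < m) {g : ι → Z → ℝ}
    (hg : ∀ i z, g i z ∈ Set.Icc (0 : ℝ) 1) (z : Fin m → Z) (k : Fin m) (w : Z) :
    familyRademacher g z - familyRademacher g (Function.update z k w) ≤ 1 / m := by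
  rw [sub_le_iff_le_add', ← average_signs_const m (1 / (m : ℝ)), familyRademacher,
    familyRademacher, ← mul_add, ← Finset.sum_add_distrib]
  refine average_signs_le fun σ => ciSup_le_ciSup_add
    (fun i => abs_signedAvg_le hm σ (hg i) _) fun i => ?_
  have := sum_update_sub_le hm (fun j x => ((σ j : ℤ) : ℝ) * g i x) (Function.update z k w) k (z k)
    (by
      have h1 := hg i (z k)
      have h2 := hg i w
      rcases Int.units_eq_one_or (σ k) with h | h <;> simp [h] <;> linarith [h1.1, h1.2, h2.1, h2.2])
  simpa [signedAvg] using this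

theorem abs_signed_difference_le {m : ℕ} (hm : 0 < m) {g : ι → Z → ℝ}
    (hg : ∀ i z, g i z ∈ Set.Icc (0 : ℝ) 1) (σ : Fin m → ℤˣ) (p : Fin m → Z × Z) (i : ι) :
    |(1 / (m : ℝ)) * ∑ k, ((σ k : ℤ) : ℝ) * (g i (p k).1 - g i (p k).2)| ≤ 1 :=
  abs_average_le hm fun k => by
    rw [abs_unit_mul]
    have h1 := hg i (p k).1
    have h2 := hg i (p k).2
    exact abs_le.2 ⟨by linarith [h1.1, h2.2], by linarith [h1.2, h2.1]⟩

variable [MeasurableSpace Z]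

theorem measurable_signedAvg {m : ℕ} (σ : Fin m → ℤˣ) {g : Z → ℝ} (hg : Measurable g) :
    Measurable (signedAvg σ g) := by
  unfold signedAvg; fun_prop

theorem measurable_familyRademacher {m : ℕ} [Countable ι] {g : ι → Z → ℝ}
    (hg : ∀ i, Measurable (g i)) : Measurable (familyRademacher (m := m) g) := by
  unfold familyRademacher
  exact (Finset.measurable_sum _ fun σ _ => .iSup fun i => measurable_signedAvg σ (hg i)).const_mul _

variable (μ : Measure Z) [IsProbabilityMeasure μ]

/-- The largest deviation `sup_i (E g_i - (1/m) ∑ k, g_i (z k))`. -/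
noncomputable def deviation {m : ℕ} (g : ι → Z → ℝ) (z : Fin m → Z) : ℝ :=
  ⨆ i, (∫ x, g i x ∂μ - (1 / (m : ℝ)) * ∑ k, g i (z k))

/-- The average of `g` over a sample is an unbiased estimator. -/
theorem integral_average {m : ℕ} (hm : 0 < m) {g : Z → ℝ} (hgm : Measurable g)
    (hg : ∀ z, g z ∈ Set.Icc (0 : ℝ) 1) :
    ∫ z, (1 / (m : ℝ)) * ∑ k, g (z k) ∂(Measure.pi fun _ : Fin m => μ) = ∫ x, g x ∂μ := by
  have hm' : (m : ℝ) ≠ 0 := by exact_mod_cast hm.ne'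
  rw [integral_const_mul, integral_finsetSum]
  · have : ∀ k : Fin m, ∫ z, g (z k) ∂(Measure.pi fun _ : Fin m => μ) = ∫ x, g x ∂μ := fun k => by
      have h := (measurePreserving_eval (fun _ : Fin m => μ) k)
      conv_rhs => rw [← h.map_eq]
      rw [integral_map h.measurable.aemeasurable hgm.aestronglyMeasurable]
    simp [this, hm']
  · exact fun k _ => integrable_of_measurable_of_abs_le (C := 1) (by fun_prop)
      fun z => by rw [abs_of_nonneg (hg _).1]; exact (hg _).2

/-- Exchanging the two members of a pair according to a sign. -/
def signSwap (u : ℤˣ) (p : Z × Z) : Z × Z := if u = 1 then p else p.swap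

theorem measurePreserving_signSwap (u : ℤˣ) :
    MeasurePreserving (signSwap u) (μ.prod μ) (μ.prod μ) := by
  unfold signSwap
  split_ifs
  · exact MeasurePreserving.id _
  · exact Measure.measurePreserving_swap

/-- Swapping the two members of the `k`-th pair whenever `σ k = -1` preserves the product law and
multiplies the `k`-th difference by `σ k`. -/
theorem integral_signed_difference_eq [Countable ι] {m : ℕ} {g : ι → Z → ℝ} (hgm : ∀ i, Measurable (g i))
    (σ : Fin m → ℤˣ) :
    ∫ p, ⨆ i, (1 / (m : ℝ)) * ∑ k, (g i (p k).1 - g i (p k).2)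
        ∂(Measure.pi fun _ : Fin m => μ.prod μ) =
      ∫ p, ⨆ i, (1 / (m : ℝ)) * ∑ k, ((σ k : ℤ) : ℝ) * (g i (p k).1 - g i (p k).2)
        ∂(Measure.pi fun _ : Fin m => μ.prod μ) := by
  have h := measurePreserving_pi (fun _ : Fin m => μ.prod μ) (fun _ : Fin m => μ.prod μ)
    (f := fun k => signSwap (σ k)) fun k => measurePreserving_signSwap μ (σ k)
  conv_lhs => rw [← h.map_eq]
  rw [integral_map h.measurable.aemeasurable
    (Measurable.iSup fun i => by fun_prop).aestronglyMeasurable]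
  congr 1
  ext p
  congr 1
  ext i
  congr 1
  refine Finset.sum_congr rfl fun k _ => ?_
  rcases Int.units_eq_one_or (σ k) with h | h <;> simp [signSwap, h]

variable [Nonempty ι] [Countable ι]

/-- Symmetrization: the expected deviation is at most twice the expected Rademacher complexity. -/
theorem integral_deviation_le {m : ℕ} (hm : 0 < m) {g : ι → Z → ℝ} (hgm : ∀ i, Measurable (g i))
    (hg : ∀ i z, g i z ∈ Set.Icc (0 : ℝ) 1) :
    ∫ z, deviation μ g z ∂(Measure.pi fun _ : Fin m => μ) ≤
      2 * ∫ z, familyRademacher g z ∂(Measure.pi fun _ : Fin m => μ) := by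
  set ν := Measure.pi fun _ : Fin m => μ
  set D : (Fin m → ℤˣ) → (Fin m → Z × Z) → ℝ := fun σ p =>
    ⨆ i, (1 / (m : ℝ)) * ∑ k, ((σ k : ℤ) : ℝ) * (g i (p k).1 - g i (p k).2) with hD
  have hDm : ∀ σ, Measurable (D σ) := fun σ => Measurable.iSup fun i => by fun_prop
  have hDb : ∀ σ p, |D σ p| ≤ 1 := fun σ p =>
    abs_ciSup_le fun i => abs_signed_difference_le hm hg σ p i
  have hgI : ∀ i, Integrable (fun z : Fin m → Z => (1 / (m : ℝ)) * ∑ k, g i (z k)) ν := fun i =>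
    integrable_of_measurable_of_abs_le (C := 1) (by fun_prop) fun z => abs_average_le hm fun k => by
      rw [abs_of_nonneg (hg _ _).1]; exact (hg _ _).2
  have hpair : Measurable fun q : (Fin m → Z) × (Fin m → Z) => fun k => (q.1 k, q.2 k) := by
    fun_prop
  have hDq : ∀ σ, Integrable
      (fun q : (Fin m → Z) × (Fin m → Z) => D σ fun k => (q.1 k, q.2 k)) (ν.prod ν) := fun σ =>
    integrable_of_measurable_of_abs_le ((hDm σ).comp hpair) fun q => hDb _ _
  -- Ghost sample: the true mean is the expected average over an independent sample `z'`, and a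
  -- supremum of integrals is at most the integral of the supremum.
  have hdom : ∀ z, deviation μ g z ≤ ∫ z', D 1 (fun k => (z' k, z k)) ∂ν := fun z => by
    refine ciSup_le fun i => ?_
    rw [← integral_average μ hm (hgm i) (hg i)]
    have : (1 / (m : ℝ)) * ∑ k, g i (z k) = ∫ _, (1 / (m : ℝ)) * ∑ k, g i (z k) ∂ν := by simp
    rw [this, ← integral_sub (hgI i) (integrable_const _)]
    refine integral_mono ((hgI i).sub (integrable_const _))
      (integrable_of_measurable_of_abs_le ((hDm 1).comp (by fun_prop)) fun z' => hDb _ _)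
      fun z' => ?_
    refine le_trans (le_of_eq ?_)
      (le_ciSup_of_abs_le (abs_signed_difference_le hm hg 1 fun k => (z' k, z k)) i)
    simp [mul_sub]
  have hdevm : Measurable (deviation (m := m) μ g) := Measurable.iSup fun i => by fun_prop
  have hprod : ∀ σ, ∫ q, D σ (fun k => (q.1 k, q.2 k)) ∂(ν.prod ν) =
      ∫ p, D σ p ∂(Measure.pi fun _ : Fin m => μ.prod μ) := fun σ => by
    have h := measurePreserving_arrowProdEquivProdArrow Z Z (Fin m) (fun _ => μ) (fun _ => μ)
    rw [← h.map_eq]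
    exact integral_map h.measurable.aemeasurable ((hDm σ).comp hpair).aestronglyMeasurable
  have h1 : ∫ z, deviation μ g z ∂ν ≤ ∫ q, D 1 (fun k => (q.1 k, q.2 k)) ∂(ν.prod ν) := by
    rw [integral_prod_symm _ (hDq 1)]
    refine integral_mono (integrable_of_measurable_of_abs_le (C := 1) hdevm fun z => ?_)
      (hDq 1).integral_prod_right hdom
    refine abs_ciSup_le fun i => ?_
    have ha : (1 / (m : ℝ)) * ∑ k, g i (z k) ∈ Set.Icc (0 : ℝ) 1 :=
      ⟨mul_nonneg (by positivity) (Finset.sum_nonneg fun k _ => (hg i _).1),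
        (le_abs_self _).trans (abs_average_le hm fun k => by
          rw [abs_of_nonneg (hg _ _).1]; exact (hg _ _).2)⟩
    have hb0 : 0 ≤ ∫ x, g i x ∂μ := integral_nonneg fun x => (hg i x).1
    have hb1 : ∫ x, g i x ∂μ ≤ 1 := by
      refine (integral_mono (integrable_of_measurable_of_abs_le (C := 1) (hgm i) fun x => ?_)
        (integrable_const (1 : ℝ)) fun x => (hg i x).2).trans (by simp)
      rw [abs_of_nonneg (hg i x).1]; exact (hg i x).2
    exact abs_le.2 ⟨by linarith [ha.2], by linarith [ha.1]⟩
  have hS : ∀ σ, Integrable (fun z : Fin m → Z => ⨆ i, signedAvg σ (g i) z) ν := fun σ =>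
    integrable_of_measurable_of_abs_le (C := 1)
      (Measurable.iSup fun i => measurable_signedAvg σ (hgm i))
      fun z => abs_ciSup_le fun i => abs_signedAvg_le hm σ (hg i) z
  -- After inserting the signs, the supremum splits into a `σ`-term on the ghost sample and a
  -- `-σ`-term on the sample. Averaging over `σ` makes the two equal, whence the factor `2`.
  have h2 : ∀ σ, ∫ q, D 1 (fun k => (q.1 k, q.2 k)) ∂(ν.prod ν) ≤
      (∫ z, ⨆ i, signedAvg σ (g i) z ∂ν) + ∫ z, ⨆ i, signedAvg (-σ) (g i) z ∂ν := fun σ => by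
    have e1 : ∫ q, D 1 (fun k => (q.1 k, q.2 k)) ∂(ν.prod ν) =
        ∫ q, D σ (fun k => (q.1 k, q.2 k)) ∂(ν.prod ν) := by
      rw [hprod, hprod, ← integral_signed_difference_eq μ hgm σ]
      simp [hD]
    have hf := (hS σ).comp_fst ν
    have hs := (hS (-σ)).comp_snd ν
    have e2 := integral_fun_fst (μ := ν) (ν := ν) (fun z : Fin m → Z => ⨆ i, signedAvg σ (g i) z)
    have e3 := integral_fun_snd (μ := ν) (ν := ν) (fun z : Fin m → Z => ⨆ i, signedAvg (-σ) (g i) z)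
    simp only [probReal_univ, one_smul] at e2 e3
    rw [e1, ← e2, ← e3, ← integral_add hf hs]
    refine integral_mono (hDq σ) (hf.add hs) fun q => ciSup_le fun i => ?_
    refine le_trans (le_of_eq ?_) (add_le_add
      (le_ciSup_of_abs_le (fun i => abs_signedAvg_le hm σ (hg i) q.1) i)
      (le_ciSup_of_abs_le (fun i => abs_signedAvg_le hm (-σ) (hg i) q.2) i))
    simp [signedAvg, mul_sub, Finset.sum_sub_distrib]
    ring
  have h3 : ∫ z, familyRademacher g z ∂ν =
      (1 / (2 : ℝ) ^ m) * ∑ σ : Fin m → ℤˣ, ∫ z, ⨆ i, signedAvg σ (g i) z ∂ν := by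
    unfold familyRademacher
    rw [integral_const_mul, integral_finsetSum _ fun σ _ => hS σ]
  have h4 : ∑ σ : Fin m → ℤˣ, ∫ z, ⨆ i, signedAvg (-σ) (g i) z ∂ν =
      ∑ σ : Fin m → ℤˣ, ∫ z, ⨆ i, signedAvg σ (g i) z ∂ν :=
    Equiv.sum_comp (Equiv.neg (Fin m → ℤˣ)) fun σ => ∫ z, ⨆ i, signedAvg σ (g i) z ∂ν
  refine h1.trans ?_
  rw [← average_signs_const m (∫ q, D 1 (fun k => (q.1 k, q.2 k)) ∂(ν.prod ν))]
  refine (average_signs_le h2).trans (le_of_eq ?_)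
  rw [Finset.sum_add_distrib, h4, h3]
  ring

/-- The uniform Rademacher bound for a countable family of `[0, 1]`-valued functions. -/
theorem uniform_bound_of_countable {m : ℕ} (hm : 0 < m) {g : ι → Z → ℝ}
    (hgm : ∀ i, Measurable (g i)) (hg : ∀ i z, g i z ∈ Set.Icc (0 : ℝ) 1) {δ : ℝ} (hδ : 0 < δ)
    (hδ' : δ < 1) :
    1 - δ ≤ (Measure.pi fun _ : Fin m => μ).real
      {z | ∀ i, ∫ x, g i x ∂μ ≤ (1 / (m : ℝ)) * ∑ k, g i (z k) + 2 * familyRademacher g z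
        + 3 * Real.sqrt (Real.log (2 / δ) / (2 * m))} := by
  have hm' : (0 : ℝ) < m := by exact_mod_cast hm
  set ν := Measure.pi fun _ : Fin m => μ
  set s := Real.sqrt (Real.log (2 / δ) / (2 * m))
  have hs : 0 ≤ s := Real.sqrt_nonneg _
  have hlog : 0 ≤ Real.log (2 / δ) := Real.log_nonneg (by rw [le_div_iff₀ hδ]; linarith)
  -- The value of `s` is chosen so that each of the two McDiarmid tails costs exactly `δ / 2`.
  have hexp : Real.exp (-(2 * m * s ^ 2)) = δ / 2 := by
    rw [Real.sq_sqrt (by positivity), mul_div_cancel₀ _ (by positivity), ← Real.log_inv,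
      Real.exp_log (by positivity), inv_div]
  have hmean : ∀ i, ∫ x, g i x ∂μ ∈ Set.Icc (0 : ℝ) 1 := fun i => by
    refine ⟨integral_nonneg fun x => (hg i x).1, ?_⟩
    refine (integral_mono (integrable_of_measurable_of_abs_le (C := 1) (hgm i) fun x => ?_)
      (integrable_const (1 : ℝ)) fun x => (hg i x).2).trans (by simp)
    rw [abs_of_nonneg (hg i x).1]; exact (hg i x).2
  have hemp : ∀ i (z : Fin m → Z), (1 / (m : ℝ)) * ∑ k, g i (z k) ∈ Set.Icc (0 : ℝ) 1 :=
    fun i z => ⟨mul_nonneg (by positivity) (Finset.sum_nonneg fun k _ => (hg i _).1),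
      (le_abs_self _).trans (abs_average_le hm fun k => by
        rw [abs_of_nonneg (hg _ _).1]; exact (hg _ _).2)⟩
  have hdev1 : ∀ (z : Fin m → Z) i,
      |∫ x, g i x ∂μ - (1 / (m : ℝ)) * ∑ k, g i (z k)| ≤ 1 := fun z i =>
    abs_le.2 ⟨by linarith [(hemp i z).2, (hmean i).1], by linarith [(hemp i z).1, (hmean i).2]⟩
  have hdevm : Measurable (deviation (m := m) μ g) := Measurable.iSup fun i => by fun_prop
  have hradm : Measurable (familyRademacher (m := m) g) := measurable_familyRademacher hgm
  have hA := measureReal_pi_ge_le μ hm (deviation μ g) hdevm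
    ⟨1, fun z => abs_ciSup_le (hdev1 z)⟩ (fun z k w => by
      rw [sub_le_iff_le_add']
      refine ciSup_le_ciSup_add (hdev1 z) fun i => ?_
      have h := sum_update_sub_le hm (fun _ x => g i x) (Function.update z k w) k (z k)
        (by linarith [(hg i (z k)).2, (hg i (Function.update z k w k)).1])
      rw [Function.update_idem, Function.update_eq_self] at h
      linarith) hs
  have hB := measureReal_pi_ge_le μ hm (fun z => -familyRademacher g z) hradm.neg
    ⟨1, fun z => by rw [abs_neg]; exact abs_familyRademacher_le hm hg z⟩ (fun z k w => by
      have := familyRademacher_sub_update_le hm hg z k w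
      linarith) hs
  rw [hexp] at hA hB
  set A := {z | ∫ w, deviation μ g w ∂ν + s ≤ deviation μ g z}
  set B := {z | ∫ w, -familyRademacher g w ∂ν + s ≤ -familyRademacher g z}
  have hAB : MeasurableSet (A ∪ B) :=
    (measurableSet_le measurable_const hdevm).union (measurableSet_le measurable_const hradm.neg)
  have hcompl : 1 - δ ≤ ν.real (A ∪ B)ᶜ := by
    rw [probReal_compl_eq_one_sub hAB]
    linarith [measureReal_union_le (μ := ν) A B]
  refine hcompl.trans (measureReal_mono fun z hz => ?_)
  rw [Set.mem_compl_iff, Set.mem_union, not_or] at hz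
  obtain ⟨hzA, hzB⟩ := hz
  simp only [A, B, Set.mem_ofPred_eq, not_le, integral_neg] at hzA hzB
  intro i
  -- Off both bad events, `deviation < E deviation + s ≤ 2 E familyRademacher + s < 2
  -- (familyRademacher + s) + s`.
  have hsym := integral_deviation_le μ hm hgm hg
  have hi : ∫ x, g i x ∂μ - (1 / (m : ℝ)) * ∑ k, g i (z k) ≤ deviation μ g z :=
    le_ciSup_of_abs_le (hdev1 z) i
  linarith

end UniformBound

/-! ### From a dense sequence of scalers to the whole hypothesis space. -/

section Generalization

theorem kron_apply {N L A B : ℕ} (T : Fin N → Matrix (Fin 1) (Fin A) ℝ)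
    (S : Fin N → Matrix (Fin L) (Fin B) ℝ) (l : Fin L) (j : Fin (A * B)) :
    kron T S l j =
      ∑ i, T i 0 (finProdFinEquiv.symm j).1 * S i l (finProdFinEquiv.symm j).2 := by
  simp [kron, Matrix.sum_apply, Equiv.uniqueProd, Subsingleton.elim (default : Fin 1) 0]

theorem continuous_kron {N L A B : ℕ} (T : Fin N → Matrix (Fin 1) (Fin A) ℝ) :
    Continuous (kron (L := L) (B := B) T) := by
  refine continuous_matrix fun l j => ?_
  simp only [kron_apply]
  fun_prop

theorem famNorm_zero {N a b : ℕ} : famNorm (0 : Fin N → Matrix (Fin a) (Fin b) ℝ) = 0 := by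
  simp [famNorm]

/-- The uniform Rademacher bound over the constrained hypothesis space. -/
theorem generalization_bound {X Y : Type*} [MeasurableSpace X] [MeasurableSpace Y]
    {N L A B q m : ℕ} (hm : 0 < m)
    (f : X → Matrix (Fin L) (Fin (A * B)) ℝ → EuclideanSpace ℝ (Fin q))
    (hfm : ∀ W, Measurable fun x => f x W) (hfc : ∀ x, Continuous (f x))
    (T : Fin N → Matrix (Fin 1) (Fin A) ℝ) {C : ℝ} (hC : 0 ≤ C)
    (loss : EuclideanSpace ℝ (Fin q) → Y → ℝ) (hloss : Measurable (Function.uncurry loss))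
    (hlc : ∀ y, Continuous fun u => loss u y)
    (μ : Measure (X × Y)) [IsProbabilityMeasure μ]
    (hμ : ∀ᵐ z ∂μ, ∀ h ∈ hypothesisSpace f T C, loss (h z.1) z.2 ∈ Set.Icc (0 : ℝ) 1)
    {δ : ℝ} (hδ : 0 < δ) (hδ' : δ < 1) :
    1 - δ ≤ (Measure.pi fun _ : Fin m => μ).real
      {z | ∀ h ∈ hypothesisSpace f T C,
        risk μ loss h ≤ empRisk z loss h + 2 * rademacher (hypothesisSpace f T C) loss z
          + 3 * Real.sqrt (Real.log (2 / δ) / (2 * m))} := by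
  classical
  have : SecondCountableTopology (Matrix (Fin L) (Fin B) ℝ) :=
    inferInstanceAs (SecondCountableTopology (Fin L → Fin B → ℝ))
  let 𝒮 := {S : Fin N → Matrix (Fin L) (Fin B) ℝ // famNorm S ≤ C}
  have : Nonempty 𝒮 := ⟨⟨0, by rw [famNorm_zero]; exact hC⟩⟩
  have : SecondCountableTopology 𝒮 := TopologicalSpace.Subtype.secondCountableTopology _
  obtain ⟨u, hu⟩ := TopologicalSpace.exists_dense_seq 𝒮
  let v : 𝒮 → X × Y → ℝ := fun S z => loss (f z.1 (kron T S.1)) z.2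
  have hvm : ∀ S, Measurable (v S) := fun S =>
    hloss.comp (((hfm _).comp measurable_fst).prodMk measurable_snd)
  have hvc : ∀ z, Continuous fun S => v S z := fun z =>
    (hlc z.2).comp ((hfc z.1).comp ((continuous_kron T).comp continuous_subtype_val))
  have hmem : ∀ S : 𝒮, (fun x => f x (kron T S.1)) ∈ hypothesisSpace f T C := fun S =>
    ⟨S.1, S.2, rfl⟩
  -- Testing only the dense sequence makes `G` a countable intersection of measurable sets;
  -- continuity and closedness of `[0, 1]` then cover every scaler.
  let G : Set (X × Y) := {z | ∀ n, v (u n) z ∈ Set.Icc (0 : ℝ) 1}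
  have hGm : MeasurableSet G := by
    have : G = ⋂ n, v (u n) ⁻¹' Set.Icc (0 : ℝ) 1 := by ext z; simp [G]
    rw [this]
    exact MeasurableSet.iInter fun n => hvm _ measurableSet_Icc
  have hGae : ∀ᵐ z ∂μ, z ∈ G := hμ.mono fun z hz n => hz _ (hmem (u n))
  have hGall : ∀ z ∈ G, ∀ S, v S z ∈ Set.Icc (0 : ℝ) 1 := fun z hz S =>
    hu.induction_on S (isClosed_Icc.preimage (hvc z)) fun n => hz n
  -- Truncation to `G` turns the almost sure bound into a bound everywhere without changing any
  -- risk.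
  let g : 𝒮 → X × Y → ℝ := fun S => G.indicator (v S)
  have hgm : ∀ S, Measurable (g S) := fun S => (hvm S).indicator hGm
  have hg : ∀ S z, g S z ∈ Set.Icc (0 : ℝ) 1 := fun S z => by
    by_cases hz : z ∈ G
    · simpa [g, hz] using hGall z hz S
    · simp [g, hz]
  have hgc : ∀ z, Continuous fun S => g S z := fun z => by
    by_cases hz : z ∈ G
    · simpa [g, hz] using hvc z
    · simpa [g, hz] using continuous_const
  have hrisk : ∀ S : 𝒮, risk μ loss (fun x => f x (kron T S.1)) = ∫ z, g S z ∂μ := fun S =>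
    integral_congr_ae (hGae.mono fun z hz => (Set.indicator_of_mem hz (v S)).symm)
  have hmean : Continuous fun S => ∫ z, g S z ∂μ :=
    continuous_of_dominated (bound := fun _ => 1) (fun S => (hgm S).aestronglyMeasurable)
      (fun S => Filter.Eventually.of_forall fun z => by
        rw [Real.norm_eq_abs, abs_of_nonneg (hg S z).1]; exact (hg S z).2)
      (integrable_const _) (Filter.Eventually.of_forall hgc)
  refine (uniform_bound_of_countable μ hm (g := fun n => g (u n)) (fun n => hgm _)
    (fun n => hg _) hδ hδ').trans ?_
  have hae : ∀ᵐ z ∂(Measure.pi fun _ : Fin m => μ), ∀ k, z k ∈ G :=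
    ae_all_iff.2 fun k =>
      (measurePreserving_eval (fun _ : Fin m => μ) k).quasiMeasurePreserving.ae hGae
  refine ENNReal.toReal_mono (measure_ne_top _ _) (measure_mono_ae ?_)
  filter_upwards [hae] with z hz hbound
  have hgz : ∀ S k, g S (z k) = v S (z k) := fun S k => Set.indicator_of_mem (hz k) _
  have hrad : familyRademacher (fun n => g (u n)) z ≤
      rademacher (hypothesisSpace f T C) loss z := by
    refine average_signs_le fun σ => ciSup_le fun n => ?_
    -- Boundedness is essential here: a real `⨆` over an unbounded family is `0`, and could not
    -- dominate its members.
    have hb : ∀ h : hypothesisSpace f T C,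
        |(1 / (m : ℝ)) * ∑ i, ((σ i : ℤ) : ℝ) * loss (h.1 (z i).1) (z i).2| ≤ 1 := by
      rintro ⟨_, S, hS, rfl⟩
      refine abs_average_le hm fun k => ?_
      have := hGall _ (hz k) ⟨S, hS⟩
      rw [abs_unit_mul, abs_of_nonneg this.1]
      exact this.2
    refine le_trans (le_of_eq ?_) (le_ciSup_of_abs_le hb ⟨_, hmem (u n)⟩)
    simp only [signedAvg, hgz]
    rfl
  rintro _ ⟨S, hS, rfl⟩
  -- Both sides are continuous in `S`, since the risk is so by dominated convergence; the inequality
  -- is therefore a closed condition, already known on the dense sequence.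
  have hall : ∀ S : 𝒮, ∫ x, g S x ∂μ ≤ (1 / (m : ℝ)) * ∑ k, g S (z k)
      + 2 * familyRademacher (fun n => g (u n)) z
      + 3 * Real.sqrt (Real.log (2 / δ) / (2 * m)) := fun S => by
    refine hu.induction_on (p := fun S => ∫ x, g S x ∂μ ≤ (1 / (m : ℝ)) * ∑ k, g S (z k)
      + 2 * familyRademacher (fun n => g (u n)) z
      + 3 * Real.sqrt (Real.log (2 / δ) / (2 * m))) S (isClosed_le hmean ?_) hbound
    exact ((continuous_const.mul (continuous_finsetSum _ fun k _ => hgc (z k))).add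
      continuous_const).add continuous_const
  have h1 := hall ⟨S, hS⟩
  rw [← hrisk] at h1
  simp only [hgz] at h1
  have h2 : empRisk z loss (fun x => f x (kron T S)) = (1 / (m : ℝ)) * ∑ k, v ⟨S, hS⟩ (z k) := rfl
  rw [h2]
  linarith

end Generalization

/-! ### Chaining for Rademacher processes over a cube. -/

section Chaining

/-- The symmetry `σ ↦ -σ` kills linear terms; this removes the value at the centre of the cube from
the chaining estimate. -/
theorem sum_signs_linear_eq_zero {m : ℕ} (a : Fin m → ℝ) :
    ∑ σ : Fin m → ℤˣ, ∑ k, ((σ k : ℤ) : ℝ) * a k = 0 := by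
  have h := Equiv.sum_comp (Equiv.neg (Fin m → ℤˣ)) fun σ => ∑ k, ((σ k : ℤ) : ℝ) * a k
  simp only [Equiv.neg_apply, Pi.neg_apply, Units.val_neg, Int.cast_neg, neg_mul,
    Finset.sum_neg_distrib] at h
  linarith

/-- The exponential moment of a Rademacher sum. -/
theorem average_signs_exp_le {m : ℕ} (a : Fin m → ℝ) :
    (1 / (2 : ℝ) ^ m) * ∑ σ : Fin m → ℤˣ, Real.exp (∑ k, ((σ k : ℤ) : ℝ) * a k) ≤
      Real.exp ((∑ k, a k ^ 2) / 2) := by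
  -- Independence of the signs: the sum over sign vectors factors into `2 cosh (a k)`, and `cosh x ≤
  -- exp (x² / 2)`.
  have h1 : ∑ σ : Fin m → ℤˣ, Real.exp (∑ k, ((σ k : ℤ) : ℝ) * a k) =
      ∏ k, (2 * Real.cosh (a k)) := by
    have h := Finset.prod_univ_sum (fun _ : Fin m => (Finset.univ : Finset ℤˣ))
      fun k u => Real.exp (((u : ℤ) : ℝ) * a k)
    rw [Fintype.piFinset_univ] at h
    simp only [Real.exp_sum]
    rw [← h]
    refine Finset.prod_congr rfl fun k _ => ?_
    rw [UnitsInt.univ, Finset.sum_pair (by decide), Real.cosh_eq]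
    simp
    ring
  rw [h1, Finset.prod_mul_distrib, Finset.sum_div, Real.exp_sum]
  simp only [Finset.prod_const, Finset.card_univ, Fintype.card_fin]
  rw [← mul_assoc, one_div, inv_mul_cancel₀ (by positivity), one_mul]
  exact Finset.prod_le_prod (fun k _ => (Real.cosh_pos _).le)
    fun k _ => Real.cosh_le_exp_half_sq _

/-- A maximal inequality for finitely many Rademacher sums. -/
theorem average_signs_iSup_le {m : ℕ} {J : Type*} [Fintype J] [Nonempty J] (v : J → Fin m → ℝ)
    {s : ℝ} (hs : 0 ≤ s) (hv : ∀ j, ∑ k, v j k ^ 2 ≤ s ^ 2) :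
    (1 / (2 : ℝ) ^ m) * ∑ σ : Fin m → ℤˣ, ⨆ j, ∑ k, ((σ k : ℤ) : ℝ) * v j k ≤
      s * (Real.log (Fintype.card J) + 1 / 2) := by
  rcases hs.eq_or_lt with rfl | hs
  · have : ∀ j k, v j k = 0 := fun j k => by
      have h := (Finset.single_le_sum (fun k _ => sq_nonneg (v j k)) (Finset.mem_univ k)).trans
        (hv j)
      exact pow_eq_zero_iff two_ne_zero |>.1 (le_antisymm (by simpa using h) (sq_nonneg _))
    simp [this]
  set X : J → (Fin m → ℤˣ) → ℝ := fun j σ => ∑ k, ((σ k : ℤ) : ℝ) * v j k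
  have hcard : (0 : ℝ) < Fintype.card J := by exact_mod_cast Fintype.card_pos
  -- Soft maximum at the fixed temperature `s`, followed by Jensen. Optimizing would give a root of
  -- the logarithm, but the dyadic sum converges without it.
  have hmax : ∀ σ, Real.exp ((⨆ j, X j σ) / s) ≤ ∑ j, Real.exp (X j σ / s) := fun σ => by
    obtain ⟨j, hj⟩ := exists_eq_ciSup_of_finite (f := fun j => X j σ)
    rw [← hj]
    exact Finset.single_le_sum (f := fun j => Real.exp (X j σ / s))
      (fun j _ => (Real.exp_pos _).le) (Finset.mem_univ j)
  have hjensen := convexOn_exp.map_sum_le (t := (Finset.univ : Finset (Fin m → ℤˣ)))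
    (w := fun _ => 1 / (2 : ℝ) ^ m) (p := fun σ => (⨆ j, X j σ) / s)
    (fun _ _ => by positivity) (by simp) (fun _ _ => Set.mem_univ _)
  simp only [smul_eq_mul, ← Finset.mul_sum] at hjensen
  have hexp : ∀ j, (1 / (2 : ℝ) ^ m) * ∑ σ, Real.exp (X j σ / s) ≤ Real.exp (1 / 2) := fun j => by
    have h := average_signs_exp_le fun k => v j k / s
    have hX : ∀ σ, X j σ / s = ∑ k, ((σ k : ℤ) : ℝ) * (v j k / s) := fun σ => by
      simp only [X, Finset.sum_div, mul_div_assoc]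
    simp only [hX]
    refine h.trans (Real.exp_le_exp.2 ?_)
    simp only [div_pow, ← Finset.sum_div]
    gcongr
    exact div_le_one_of_le₀ (hv j) (by positivity)
  have htotal : Real.exp ((1 / (2 : ℝ) ^ m) * ∑ σ, (⨆ j, X j σ) / s) ≤
      Fintype.card J * Real.exp (1 / 2) := by
    refine hjensen.trans ((average_signs_le hmax).trans ?_)
    rw [Finset.sum_comm, Finset.mul_sum]
    simpa using Finset.sum_le_sum fun j (_ : j ∈ Finset.univ) => hexp j
  have hlog := (Real.le_log_iff_exp_le (by positivity)).2 htotal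
  rw [Real.log_mul hcard.ne' (Real.exp_pos _).ne', Real.log_exp, ← Finset.sum_div, ← mul_div_assoc,
    div_le_iff₀ hs] at hlog
  linarith

variable {κ : Type*} [Fintype κ]

/-- Dyadic grids of a cube; the coarsest one is the centre. -/
theorem exists_dyadic_grid {r : ℝ} (hr : 0 ≤ r) (k : ℕ) :
    ∃ p : (κ → Fin (2 ^ (k + 1) + 1)) → κ → ℝ, (∀ a, ‖p a‖ ≤ r) ∧ (k = 0 → ∀ a, p a = 0) ∧
      ∀ w : κ → ℝ, ‖w‖ ≤ r → ∃ a, ‖w - p a‖ ≤ r / 2 ^ k := by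
  rcases Nat.eq_zero_or_pos k with rfl | hk
  · exact ⟨0, by simpa using hr, by simp, fun w hw => ⟨0, by simpa using hw⟩⟩
  -- The index `a j` runs through `0, …, 2 ^ (k + 1)`, giving mesh `r / 2 ^ k` on `[-r, r]`; points
  -- are approximated by rounding each coordinate down.
  refine ⟨fun a j => r * ((a j : ℕ) / 2 ^ k - 1), fun a => ?_, fun h => absurd h hk.ne',
    fun w hw => ?_⟩
  · refine (pi_norm_le_iff_of_nonneg hr).2 fun j => ?_
    have h1 : ((a j : ℕ) : ℝ) ≤ 2 ^ (k + 1) := by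
      exact_mod_cast Nat.lt_succ_iff.1 (a j).2
    have h2 : ((a j : ℕ) : ℝ) / 2 ^ k ≤ 2 := by
      rw [div_le_iff₀ (by positivity)]; linarith [pow_succ (2 : ℝ) k]
    have h3 : 0 ≤ ((a j : ℕ) : ℝ) / 2 ^ k := by positivity
    rw [Real.norm_eq_abs, abs_mul, abs_of_nonneg hr]
    exact mul_le_of_le_one_right hr (abs_le.2 ⟨by linarith, by linarith⟩)
  · rcases hr.eq_or_lt with rfl | hr
    · refine ⟨0, ?_⟩
      have : w = 0 := norm_le_zero_iff.1 hw
      simp [this, Pi.zero_def]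
    have hwj : ∀ j, |w j| ≤ r := fun j => (norm_le_pi_norm w j).trans hw
    have hpos : ∀ j, 0 ≤ (w j / r + 1) * 2 ^ k := fun j => by
      have : -1 ≤ w j / r := by rw [le_div_iff₀ hr]; linarith [(abs_le.1 (hwj j)).1]
      exact mul_nonneg (by linarith) (by positivity)
    have hle : ∀ j, (w j / r + 1) * 2 ^ k ≤ ((2 ^ (k + 1) : ℕ) : ℝ) := fun j => by
      have : w j / r ≤ 1 := by rw [div_le_iff₀ hr]; linarith [(abs_le.1 (hwj j)).2]
      push_cast
      rw [pow_succ]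
      nlinarith [pow_pos (zero_lt_two' ℝ) k]
    refine ⟨fun j => ⟨⌊(w j / r + 1) * 2 ^ k⌋₊, Nat.lt_succ_iff.2 (Nat.floor_le_of_le (hle j))⟩,
      (pi_norm_le_iff_of_nonneg (by positivity)).2 fun j => ?_⟩
    have h1 := Nat.floor_le (hpos j)
    have h2 := Nat.lt_floor_add_one ((w j / r + 1) * 2 ^ k)
    set x : ℝ := (⌊(w j / r + 1) * 2 ^ k⌋₊ : ℝ)
    have heq : w j - r * (x / 2 ^ k - 1) = r / 2 ^ k * ((w j / r + 1) * 2 ^ k - x) := by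
      field_simp
      ring
    rw [Pi.sub_apply, Real.norm_eq_abs, heq, abs_mul, abs_of_nonneg (by positivity : 0 ≤ r / 2 ^ k)]
    exact mul_le_of_le_one_right (by positivity) (abs_le.2 ⟨by linarith, by linarith⟩)

/-- Growth linear in the level suffices, since the mesh decays geometrically. The constant comes
from `2 ^ (k+1) + 1 ≤ 2 ^ (2(k+1)) ≤ e ^ (2(k+1))`. -/
theorem log_card_grid_le [DecidableEq κ] (k : ℕ) :
    Real.log (Fintype.card (κ → Fin (2 ^ (k + 1) + 1))) ≤ 2 * (k + 1) * Fintype.card κ := by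
  rw [Fintype.card_fun, Fintype.card_fin]
  push_cast
  rw [Real.log_pow, mul_comm]
  gcongr
  have h1 : (2 : ℝ) ^ (k + 1) + 1 ≤ Real.exp 1 ^ (2 * (k + 1)) := by
    have he : (2 : ℝ) ≤ Real.exp 1 := by linarith [Real.add_one_le_exp (1 : ℝ)]
    have h2 : (2 : ℝ) ≤ 2 ^ (k + 1) := by
      rw [pow_succ]; linarith [one_le_pow₀ (one_le_two (α := ℝ)) (n := k)]
    calc (2 : ℝ) ^ (k + 1) + 1 ≤ 2 ^ (2 * (k + 1)) := by
          rw [two_mul, pow_add 2 (k + 1) (k + 1)]; nlinarith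
      _ ≤ _ := by gcongr
  rw [Real.log_le_iff_le_exp (by positivity)]
  refine h1.trans (le_of_eq ?_)
  rw [← Real.exp_nat_mul]
  push_cast
  ring_nf

theorem sum_succ_div_two_pow_le (n : ℕ) :
    ∑ k ∈ Finset.range n, ((k : ℝ) + 1) / 2 ^ k ≤ 4 := by
  have h : ∑ k ∈ Finset.range n, ((k : ℝ) + 1) / 2 ^ k = 4 - (2 * n + 4) / 2 ^ n := by
    induction n with
    | zero => norm_num
    | succ n ih =>
      rw [Finset.sum_range_succ, ih, pow_succ]
      push_cast
      field_simp
      ring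
  rw [h]
  have : (0 : ℝ) ≤ (2 * n + 4) / 2 ^ n := by positivity
  linarith

/-- Chaining over a cube: the expected supremum of a Rademacher process with Lipschitz increments,
indexed by points of a cube of finite dimension. -/
theorem average_signs_iSup_lipschitz_le {ι : Type*} [Nonempty ι] {m : ℕ} {r A : ℝ} (hr : 0 ≤ r)
    (hA : 0 ≤ A) (g : (κ → ℝ) → Fin m → ℝ)
    (hg : ∀ w w', ‖w‖ ≤ r → ‖w'‖ ≤ r → ∀ k, |g w k - g w' k| ≤ A * ‖w - w'‖)
    (w : ι → κ → ℝ) (hw : ∀ i, ‖w i‖ ≤ r) :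
    (1 / (2 : ℝ) ^ m) * ∑ σ : Fin m → ℤˣ, ⨆ i, ∑ k, ((σ k : ℤ) : ℝ) * g (w i) k ≤
      48 * (Fintype.card κ + 1) * (A * r) * Real.sqrt m := by
  classical
  choose p hpr hp0 hpw using exists_dyadic_grid (κ := κ) hr
  choose! a ha using hpw
  -- Links between consecutive grids. Long links are replaced by `0`, so the maximal inequality
  -- applies to all pairs of grid points; the chains only use short ones.
  let v : (n : ℕ) → (κ → Fin (2 ^ (n + 1) + 1)) × (κ → Fin (2 ^ (n + 1 + 1) + 1)) → Fin m → ℝ :=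
    fun n b k => if ‖p (n + 1) b.2 - p n b.1‖ ≤ 2 * r / 2 ^ n
      then g (p (n + 1) b.2) k - g (p n b.1) k else 0
  let V : ℕ → (Fin m → ℤˣ) → ℝ := fun n σ => ⨆ b, ∑ k, ((σ k : ℤ) : ℝ) * v n b k
  have hv : ∀ n b, ∑ k, v n b k ^ 2 ≤ (Real.sqrt m * (A * (2 * r / 2 ^ n))) ^ 2 := fun n b => by
    rw [mul_pow, Real.sq_sqrt (Nat.cast_nonneg m)]
    refine (Finset.sum_le_card_nsmul _ _ ((A * (2 * r / 2 ^ n)) ^ 2) fun k _ => ?_).trans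
      (by simp)
    simp only [v]
    split_ifs with h
    · refine sq_le_sq' ?_ ?_ <;>
      have := (hg _ _ (hpr (n + 1) b.2) (hpr n b.1) k).trans (mul_le_mul_of_nonneg_left h hA)
      · exact (abs_le.1 this).1
      · exact (abs_le.1 this).2
    · simpa using sq_nonneg _
  -- The link size `2 A r / 2 ^ n` times the logarithmic factor `6 (card κ + 1) (n + 1)` gives `12`;
  -- summing `(n + 1) / 2 ^ n ≤ 4` gives `48`.
  have hV : ∀ n, (1 / (2 : ℝ) ^ m) * ∑ σ, V n σ ≤
      12 * (Fintype.card κ + 1) * (A * r) * Real.sqrt m * ((n + 1) / 2 ^ n) := fun n => by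
    refine (average_signs_iSup_le (v n) (by positivity) (hv n)).trans ?_
    have hl1 := log_card_grid_le (κ := κ) n
    have hl2 := log_card_grid_le (κ := κ) (n + 1)
    have hlog : Real.log (Fintype.card ((κ → Fin (2 ^ (n + 1) + 1)) ×
        (κ → Fin (2 ^ (n + 1 + 1) + 1)))) + 1 / 2 ≤ 6 * (Fintype.card κ + 1) * (n + 1) := by
      rw [Fintype.card_prod, Nat.cast_mul, Real.log_mul (Nat.cast_ne_zero.2 Fintype.card_ne_zero)
        (Nat.cast_ne_zero.2 Fintype.card_ne_zero)]
      rw [Nat.cast_add_one] at hl2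
      have : (0 : ℝ) ≤ Fintype.card κ := Nat.cast_nonneg _
      have : (0 : ℝ) ≤ n := Nat.cast_nonneg _
      nlinarith
    refine (mul_le_mul_of_nonneg_left hlog (by positivity)).trans (le_of_eq ?_)
    ring
  have hstep : ∀ (n : ℕ) (i : ι), ‖p (n + 1) (a (n + 1) (w i)) - p n (a n (w i))‖ ≤
      2 * r / 2 ^ n := fun n i => by
    have h1 := ha n (w i) (hw i)
    have h2 := ha (n + 1) (w i) (hw i)
    have h3 : r / 2 ^ (n + 1) ≤ r / 2 ^ n := by
      gcongr
      · norm_num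
      · omega
    calc _ = ‖(w i - p n (a n (w i))) - (w i - p (n + 1) (a (n + 1) (w i)))‖ := by congr 1; abel
      _ ≤ _ := (norm_sub_le _ _).trans (by rw [mul_div_assoc]; linarith)
  have hfin : ∀ (K : ℕ) (σ : Fin m → ℤˣ), ⨆ i, ∑ k, ((σ k : ℤ) : ℝ) * g (w i) k ≤
      ∑ k, ((σ k : ℤ) : ℝ) * g 0 k + ∑ n ∈ Finset.range K, V n σ + m * (A * (r / 2 ^ K)) :=
    fun K σ => by
    refine ciSup_le fun i => ?_
    -- The chain starts at `g 0` because the coarsest grid is the centre alone; the remainder after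
    -- level `K` is bounded crudely and vanishes as `K → ∞`.
    have htel : ∀ k, g (w i) k = g 0 k + ∑ n ∈ Finset.range K,
        (g (p (n + 1) (a (n + 1) (w i))) k - g (p n (a n (w i))) k)
        + (g (w i) k - g (p K (a K (w i))) k) := fun k => by
      rw [Finset.sum_range_sub (fun n => g (p n (a n (w i))) k) K, hp0 0 rfl]
      ring
    have hsplit : ∑ k, ((σ k : ℤ) : ℝ) * g (w i) k = ∑ k, ((σ k : ℤ) : ℝ) * g 0 k
        + ∑ n ∈ Finset.range K, ∑ k, ((σ k : ℤ) : ℝ) *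
          (g (p (n + 1) (a (n + 1) (w i))) k - g (p n (a n (w i))) k)
        + ∑ k, ((σ k : ℤ) : ℝ) * (g (w i) k - g (p K (a K (w i))) k) := by
      rw [Finset.sum_comm, ← Finset.sum_add_distrib, ← Finset.sum_add_distrib]
      refine Finset.sum_congr rfl fun k _ => ?_
      rw [← Finset.mul_sum, ← mul_add, ← mul_add, ← htel k]
    rw [hsplit]
    gcongr with n hn k hk
    · refine le_trans (le_of_eq ?_) (le_ciSup (Set.finite_range _).bddAbove
        (a n (w i), a (n + 1) (w i)))
      refine Finset.sum_congr rfl fun k _ => ?_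
      simp only [v]
      rw [if_pos (hstep n i)]
    · refine (Finset.sum_le_card_nsmul _ _ (A * (r / 2 ^ K)) fun k _ => ?_).trans (by simp)
      refine (le_abs_self _).trans ?_
      rw [abs_unit_mul]
      exact (hg _ _ (hw i) (hpr K _) k).trans (mul_le_mul_of_nonneg_left (ha K _ (hw i)) hA)
  have hbound : ∀ K : ℕ, (1 / (2 : ℝ) ^ m) * ∑ σ : Fin m → ℤˣ, ⨆ i, ∑ k,
      ((σ k : ℤ) : ℝ) * g (w i) k ≤
        48 * (Fintype.card κ + 1) * (A * r) * Real.sqrt m + m * (A * r) * (1 / 2) ^ K := fun K => by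
    refine (average_signs_le (hfin K)).trans ?_
    rw [Finset.sum_add_distrib, Finset.sum_add_distrib, sum_signs_linear_eq_zero, zero_add, mul_add,
      average_signs_const, Finset.sum_comm, Finset.mul_sum]
    refine add_le_add ((Finset.sum_le_sum fun n _ => hV n).trans ?_) (le_of_eq ?_)
    · rw [← Finset.mul_sum]
      refine (mul_le_mul_of_nonneg_left (sum_succ_div_two_pow_le K) (by positivity)).trans
        (le_of_eq ?_)
      ring
    · rw [one_div, inv_pow]
      ring
  have hlim : Filter.Tendsto (fun K : ℕ => 48 * ((Fintype.card κ : ℝ) + 1) * (A * r) * Real.sqrt m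
      + m * (A * r) * (1 / 2) ^ K) Filter.atTop
      (nhds (48 * (Fintype.card κ + 1) * (A * r) * Real.sqrt m + m * (A * r) * 0)) :=
    ((tendsto_pow_atTop_nhds_zero_of_lt_one (by norm_num) (by norm_num)).const_mul _).const_add _
  simpa using ge_of_tendsto' hlim hbound

end Chaining

/-! ### A calculus of maps bounded and Lipschitz at a given scale. -/

section Tame

variable {Θ W : Type*}

/-- The norm of `v` is at most a multiple of the scale `s`. -/
def Dominated {E : Type*} [SeminormedAddCommGroup E] (s : Θ → ℝ) (v : E) : Prop :=
  ∃ c : ℝ, 0 ≤ c ∧ ∀ θ, ‖v‖ ≤ c * s θ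

/-- The place where the alternative "input radius at least `ρ`, or no offsets" is used: a fixed `v`
is absorbed into the scale at the cost `‖v‖ / ρ`. -/
theorem Dominated.of_le_or_eq_zero {E : Type*} [SeminormedAddCommGroup E] {s : Θ → ℝ} {v : E}
    {ρ : ℝ} (hρ : 0 < ρ) (hs : ∀ θ, 0 ≤ s θ) (h : ∀ θ, ρ ≤ s θ ∨ v = 0) : Dominated s v := by
  refine ⟨‖v‖ / ρ, by positivity, fun θ => ?_⟩
  rcases h θ with h | rfl
  · rw [div_mul_eq_mul_div, le_div_iff₀ hρ]
    exact mul_le_mul_of_nonneg_left h (norm_nonneg v)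
  · rw [norm_zero]
    exact mul_nonneg (by positivity) (hs θ)

variable [PseudoMetricSpace W]

/-- A family of maps `Φ θ : W → E` is tame at scale `s` if `Φ θ` is bounded by a multiple of `s θ` and
Lipschitz with constant a multiple of `s θ`, uniformly in `θ`. -/
def Tame {E : Type*} [SeminormedAddCommGroup E] (s : Θ → ℝ) (Φ : Θ → W → E) : Prop :=
  ∃ c : ℝ, 0 ≤ c ∧ ∀ θ, (∀ w, ‖Φ θ w‖ ≤ c * s θ) ∧
    ∀ w w', ‖Φ θ w - Φ θ w'‖ ≤ c * s θ * dist w w'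

namespace Tame

section Group

variable {E F : Type*} [SeminormedAddCommGroup E] [SeminormedAddCommGroup F] {s t : Θ → ℝ}

theorem add {Φ Ψ : Θ → W → E} (h₁ : Tame s Φ) (h₂ : Tame s Ψ) :
    Tame s fun θ w => Φ θ w + Ψ θ w := by
  obtain ⟨c, hc, h⟩ := h₁
  obtain ⟨c', hc', h'⟩ := h₂
  refine ⟨c + c', by positivity, fun θ => ⟨fun w => ?_, fun w w' => ?_⟩⟩
  · linarith [norm_add_le (Φ θ w) (Ψ θ w), (h θ).1 w, (h' θ).1 w]
  · rw [add_sub_add_comm]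
    linarith [norm_add_le (Φ θ w - Φ θ w') (Ψ θ w - Ψ θ w'), (h θ).2 w w', (h' θ).2 w w']

theorem const {v : E} (hv : Dominated s v) :
    Tame s fun (_ : Θ) (_ : W) => v := by
  obtain ⟨c, hc, h⟩ := hv
  refine ⟨c, hc, fun θ => ⟨fun w => h θ, fun w w' => ?_⟩⟩
  rw [sub_self, norm_zero]
  exact mul_nonneg ((norm_nonneg v).trans (h θ)) dist_nonneg

theorem sum {J : Type*} (S : Finset J) {Φ : J → Θ → W → E}
    (h : ∀ j, Tame s (Φ j)) : Tame s fun θ w => ∑ j ∈ S, Φ j θ w := by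
  classical
  induction S using Finset.induction_on with
  | empty =>
    simp only [Finset.sum_empty]
    exact const ⟨0, le_rfl, fun θ => by simp⟩
  | insert j S hj ih =>
    simp only [Finset.sum_insert hj]
    exact (h j).add ih

theorem scale_mono {Φ : Θ → W → E} (h : Tame s Φ) {C : ℝ} (hC : 0 ≤ C)
    (hst : ∀ θ, s θ ≤ C * t θ) : Tame t Φ := by
  obtain ⟨c, hc, h⟩ := h
  have hle : ∀ θ, c * s θ ≤ c * C * t θ := fun θ => by
    rw [mul_assoc]; exact mul_le_mul_of_nonneg_left (hst θ) hc
  exact ⟨c * C, by positivity, fun θ => ⟨fun w => ((h θ).1 w).trans (hle θ), fun w w' =>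
    ((h θ).2 w w').trans (mul_le_mul_of_nonneg_right (hle θ) dist_nonneg)⟩⟩

/-- Postcomposition with a Lipschitz map whose value at `0` is dominated by the scale. -/
theorem comp_lipschitz {Φ : Θ → W → E} (h : Tame s Φ) {g : E → F} {K : NNReal}
    (hg : LipschitzWith K g) (h0 : Dominated s (g 0)) :
    Tame s fun θ w => g (Φ θ w) := by
  obtain ⟨c, hc, h⟩ := h
  obtain ⟨c', hc', h0⟩ := h0
  refine ⟨K * c + c', by positivity, fun θ => ⟨fun w => ?_, fun w w' => ?_⟩⟩
  · have h1 := hg.norm_sub_le (Φ θ w) 0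
    rw [sub_zero] at h1
    have h2 := norm_le_norm_sub_add (g (Φ θ w)) (g 0)
    have h3 := mul_le_mul_of_nonneg_left ((h θ).1 w) K.coe_nonneg
    linarith [h0 θ]
  · have h1 := hg.norm_sub_le (Φ θ w) (Φ θ w')
    have h3 := mul_le_mul_of_nonneg_left ((h θ).2 w w') K.coe_nonneg
    have h4 : 0 ≤ c' * s θ * dist w w' :=
      mul_nonneg ((norm_nonneg _).trans (h0 θ)) dist_nonneg
    linarith

end Group

section Real

variable {s t u : Θ → ℝ}

/-- Scales multiply, and the product rule costs a factor `2`. The free target scale `u` allows a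
bounded factor of the scale to be discarded. -/
theorem mul {φ ψ : Θ → W → ℝ} (h₁ : Tame s φ) (h₂ : Tame t ψ) {C : ℝ} (hC : 0 ≤ C)
    (hst : ∀ θ, s θ * t θ ≤ C * u θ) : Tame u fun θ w => φ θ w * ψ θ w := by
  suffices h : Tame (fun θ => s θ * t θ) fun θ w => φ θ w * ψ θ w from h.scale_mono hC hst
  obtain ⟨c, hc, h⟩ := h₁
  obtain ⟨c', hc', h'⟩ := h₂
  refine ⟨2 * (c * c'), by positivity, fun θ => ⟨fun w => ?_, fun w w' => ?_⟩⟩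
  · have h1 := mul_le_mul ((h θ).1 w) ((h' θ).1 w) (norm_nonneg _)
      ((norm_nonneg _).trans ((h θ).1 w))
    rw [norm_mul]
    linarith [mul_nonneg (norm_nonneg (φ θ w)) (norm_nonneg (ψ θ w))]
  · have h1 := mul_le_mul ((h θ).1 w) ((h' θ).2 w w') (norm_nonneg _)
      ((norm_nonneg _).trans ((h θ).1 w))
    have h2 := mul_le_mul ((h θ).2 w w') ((h' θ).1 w') (norm_nonneg _)
      ((norm_nonneg _).trans ((h θ).2 w w'))
    have heq : φ θ w * ψ θ w - φ θ w' * ψ θ w' =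
        φ θ w * (ψ θ w - ψ θ w') + (φ θ w - φ θ w') * ψ θ w' := by ring
    rw [heq]
    refine (norm_add_le _ _).trans ?_
    rw [norm_mul, norm_mul]
    linarith

theorem const_mul {φ : Θ → W → ℝ} (h : Tame s φ) (a : ℝ) : Tame s fun θ w => a * φ θ w :=
  mul (s := fun _ => 1) (const ⟨‖a‖, norm_nonneg _, by simp⟩) h zero_le_one (by simp)

/-- Bounded arguments keep the slope of the exponential below `exp c`; the tangent line inequality
gives the Lipschitz estimate. -/
theorem exp {φ : Θ → W → ℝ} (h : Tame (fun _ => 1) φ) :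
    Tame (fun _ => 1) fun θ w => Real.exp (φ θ w) := by
  obtain ⟨c, hc, h⟩ := h
  simp only [mul_one, Real.norm_eq_abs] at h
  have hle : ∀ θ w, Real.exp (φ θ w) ≤ Real.exp c := fun θ w =>
    Real.exp_le_exp.2 ((le_abs_self _).trans ((h θ).1 w))
  have key : ∀ θ w w', Real.exp (φ θ w) - Real.exp (φ θ w') ≤
      Real.exp c * |φ θ w - φ θ w'| := fun θ w w' => by
    have h1 := Real.add_one_le_exp (φ θ w' - φ θ w)
    have h2 : Real.exp (φ θ w') = Real.exp (φ θ w) * Real.exp (φ θ w' - φ θ w) := by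
      rw [← Real.exp_add]; ring_nf
    have h3 := mul_le_mul_of_nonneg_left h1 (Real.exp_pos (φ θ w)).le
    have h4 : Real.exp (φ θ w) * (φ θ w - φ θ w') ≤ Real.exp c * |φ θ w - φ θ w'| :=
      (mul_le_mul_of_nonneg_left (le_abs_self _) (Real.exp_pos _).le).trans
        (mul_le_mul_of_nonneg_right (hle θ w) (abs_nonneg _))
    linarith
  refine ⟨Real.exp c * (c + 1), by positivity, fun θ => ⟨fun w => ?_, fun w w' => ?_⟩⟩
  · rw [Real.norm_eq_abs, abs_of_pos (Real.exp_pos _), mul_one]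
    exact (hle θ w).trans (le_mul_of_one_le_right (Real.exp_pos _).le (by linarith))
  · have h1 : |Real.exp (φ θ w) - Real.exp (φ θ w')| ≤ Real.exp c * |φ θ w - φ θ w'| :=
      abs_sub_le_iff.2 ⟨key θ w w', by rw [abs_sub_comm]; exact key θ w' w⟩
    rw [Real.norm_eq_abs, mul_one, mul_assoc]
    refine h1.trans (mul_le_mul_of_nonneg_left (((h θ).2 w w').trans ?_) (Real.exp_pos _).le)
    exact mul_le_mul_of_nonneg_right (by linarith) dist_nonneg

theorem inv {φ : Θ → W → ℝ} (h : Tame (fun _ => 1) φ) {ε : ℝ} (hε : 0 < ε)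
    (hφ : ∀ θ w, ε ≤ φ θ w) : Tame (fun _ => 1) fun θ w => (φ θ w)⁻¹ := by
  obtain ⟨c, hc, h⟩ := h
  simp only [mul_one, Real.norm_eq_abs] at h
  have hpos : ∀ θ w, 0 < φ θ w := fun θ w => hε.trans_le (hφ θ w)
  have hinv : ∀ θ w, (φ θ w)⁻¹ ≤ ε⁻¹ := fun θ w => inv_anti₀ hε (hφ θ w)
  refine ⟨ε⁻¹ + ε⁻¹ * ε⁻¹ * c, by positivity, fun θ => ⟨fun w => ?_, fun w w' => ?_⟩⟩
  · rw [Real.norm_eq_abs, abs_of_pos (inv_pos.2 (hpos θ w)), mul_one]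
    exact (hinv θ w).trans (le_add_of_nonneg_right (by positivity))
  · have heq : (φ θ w)⁻¹ - (φ θ w')⁻¹ = (φ θ w)⁻¹ * (φ θ w')⁻¹ * (φ θ w' - φ θ w) := by
      have := (hpos θ w).ne'
      have := (hpos θ w').ne'
      field_simp
    rw [heq, Real.norm_eq_abs, abs_mul, abs_mul, abs_of_pos (inv_pos.2 (hpos θ w)),
      abs_of_pos (inv_pos.2 (hpos θ w')), mul_one, abs_sub_comm, add_mul]
    have h1 : (φ θ w)⁻¹ * (φ θ w')⁻¹ ≤ ε⁻¹ * ε⁻¹ :=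
      mul_le_mul (hinv θ w) (hinv θ w') (inv_pos.2 (hpos θ w')).le (by positivity)
    have h2 := mul_le_mul h1 ((h θ).2 w w') (abs_nonneg _) (by positivity)
    have h3 : 0 ≤ ε⁻¹ * dist w w' := by positivity
    linarith

end Real

end Tame

end Tame

/-! ### Tame matrix families. -/

section Matrices

variable {Θ W : Type*} [PseudoMetricSpace W] {s t u : Θ → ℝ}

/-- Tameness of a matrix-valued family, entry by entry. -/
def TameMatrix {a b : Type*} (s : Θ → ℝ) (Φ : Θ → W → Matrix a b ℝ) : Prop :=
  ∀ i j, Tame s fun θ w => Φ θ w i j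

namespace TameMatrix

variable {a b c : Type*}

theorem mul [Fintype b] {Φ : Θ → W → Matrix a b ℝ} {Ψ : Θ → W → Matrix b c ℝ}
    (h₁ : TameMatrix s Φ) (h₂ : TameMatrix t Ψ) {C : ℝ} (hC : 0 ≤ C)
    (hst : ∀ θ, s θ * t θ ≤ C * u θ) : TameMatrix u fun θ w => Φ θ w * Ψ θ w := fun i j => by
  simp only [Matrix.mul_apply]
  exact Tame.sum _ fun k => (h₁ i k).mul (h₂ k j) hC hst

theorem add {Φ Ψ : Θ → W → Matrix a b ℝ} (h₁ : TameMatrix s Φ)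
    (h₂ : TameMatrix s Ψ) : TameMatrix s fun θ w => Φ θ w + Ψ θ w :=
  fun i j => (h₁ i j).add (h₂ i j)

theorem smul {Φ : Θ → W → Matrix a b ℝ} (h : TameMatrix s Φ) (x : ℝ) :
    TameMatrix s fun θ w => x • Φ θ w := fun i j => (h i j).const_mul x

/-- The denominator contains the exponential of the entry `(i, j)` itself, hence stays above `exp
(-c)` for any bound `c` of that entry. -/
theorem softmax {n k : ℕ} {Φ : Θ → W → Matrix (Fin n) (Fin k) ℝ}
    (h : TameMatrix (fun _ => 1) Φ) : TameMatrix (fun _ => 1) fun θ w => softmax (Φ θ w) :=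
  fun i j => by
  simp only [WeiT.softmax, Matrix.of_apply, div_eq_mul_inv]
  refine (h i j).exp.mul (Tame.inv (ε := Real.exp (-(h i j).choose)) ?_ (Real.exp_pos _) ?_)
    zero_le_one (by simp)
  · exact Tame.sum _ fun j' => (h i j').exp
  · intro θ w
    have h1 := ((h i j).choose_spec.2 θ).1 w
    rw [mul_one] at h1
    exact (Real.exp_le_exp.2 (neg_le_of_abs_le h1)).trans
      (Finset.single_le_sum (f := fun j' => Real.exp (Φ θ w i j'))
        (fun _ _ => (Real.exp_pos _).le) (Finset.mem_univ j))

attribute [local instance] Matrix.frobeniusNormedAddCommGroup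

theorem norm_entry_le [Fintype a] [Fintype b] (A : Matrix a b ℝ) (i : a) (j : b) :
    ‖A i j‖ ≤ ‖A‖ := by
  rw [Matrix.frobenius_norm_def, ← Real.sqrt_eq_rpow]
  refine Real.le_sqrt_of_sq_le ?_
  simp only [Real.rpow_two]
  exact (Finset.single_le_sum (f := fun j => ‖A i j‖ ^ 2) (fun _ _ => sq_nonneg _)
    (Finset.mem_univ j)).trans (Finset.single_le_sum (f := fun i => ∑ j, ‖A i j‖ ^ 2)
      (fun _ _ => Finset.sum_nonneg fun _ _ => sq_nonneg _) (Finset.mem_univ i))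

theorem norm_single [Fintype a] [Fintype b] [DecidableEq a] [DecidableEq b] (i : a) (j : b)
    (x : ℝ) : ‖Matrix.single i j x‖ = ‖x‖ := by
  rw [Matrix.frobenius_norm_def, ← Real.sqrt_eq_rpow]
  have : ∑ i', ∑ j', ‖Matrix.single i j x i' j'‖ ^ (2 : ℝ) = ‖x‖ ^ 2 := by
    rw [Finset.sum_eq_single i, Finset.sum_eq_single j]
    · simp
    · intro j' _ hj
      simp [hj.symm]
    · simp
    · intro i' _ hi
      simp [hi.symm]
    · simp
  rw [this, Real.sqrt_sq (norm_nonneg _)]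

theorem of_tame [Fintype a] [Fintype b] {Φ : Θ → W → Matrix a b ℝ} (h : Tame s Φ) :
    TameMatrix s Φ := fun i j => by
  obtain ⟨c, hc, h⟩ := h
  exact ⟨c, hc, fun θ => ⟨fun w => (norm_entry_le _ i j).trans ((h θ).1 w),
    fun w w' => (norm_entry_le (Φ θ w - Φ θ w') i j).trans ((h θ).2 w w')⟩⟩

/-- A matrix is the sum of its single-entry parts, whose Frobenius norms are the absolute entries.
Entrywise tameness suits products and softmax; the Frobenius form suits the frozen Lipschitz maps.
-/
theorem tame [Fintype a] [Fintype b] {Φ : Θ → W → Matrix a b ℝ}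
    (h : TameMatrix s Φ) : Tame s Φ := by
  classical
  have heq : Φ = fun θ w => ∑ i, ∑ j, Matrix.single i j (Φ θ w i j) := by
    funext θ w
    exact Matrix.matrix_eq_sum_single _
  rw [heq]
  refine Tame.sum _ fun i => Tame.sum _ fun j => ?_
  obtain ⟨c, hc, h⟩ := h i j
  refine ⟨c, hc, fun θ => ⟨fun w => ?_, fun w w' => ?_⟩⟩
  · rw [norm_single]; exact (h θ).1 w
  · have hsub := (map_sub (Matrix.singleAddMonoidHom (α := ℝ) i j) (Φ θ w i j) (Φ θ w' i j)).symm
    simp only [Matrix.singleAddMonoidHom_apply] at hsub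
    rw [hsub, norm_single]
    exact (h θ).2 w w'

theorem comp_frobLipschitz {n D : ℕ} {Φ : Θ → W → Matrix (Fin n) (Fin D) ℝ} (h : TameMatrix s Φ)
    {g : Matrix (Fin n) (Fin D) ℝ → Matrix (Fin n) (Fin D) ℝ} (hg : FrobLipschitz g)
    (h0 : Dominated s (g 0)) : TameMatrix s fun θ w => g (Φ θ w) := by
  obtain ⟨K, hK⟩ := hg
  exact of_tame (h.tame.comp_lipschitz hK h0)

end TameMatrix

end Matrices

theorem foldl_induction {Θ W E : Type*} (P : (Θ → W → E) → Prop) {k : ℕ}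
    (F : Fin k → Θ → W → E → E) (hF : ∀ l Φ, P Φ → P fun θ w => F l θ w (Φ θ w))
    {Φ : Θ → W → E} (hΦ : P Φ) : P fun θ w => Fin.foldl k (fun Z l => F l θ w Z) (Φ θ w) := by
  induction k with
  | zero => simpa using hΦ
  | succ k ih =>
    simp only [Fin.foldl_succ_last]
    exact hF (Fin.last k) _ (ih (fun l => F l.castSucc) fun l => hF l.castSucc)

/-! ### Transformer layers preserve tameness at the input scale. -/

section Layers

attribute [local instance] Matrix.frobeniusNormedAddCommGroup

variable {Θ W : Type*} [PseudoMetricSpace W] {τ : Θ → ℝ} {Λ : ℝ}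
  {n H d D D' : ℕ}

/-- The scores have scale `τ² ≤ Λ²`, so they are tame at scale `1`, and so is their softmax; the
single factor `Z V` restores the scale `τ`. -/
theorem tameMatrix_head (hτ : ∀ θ, 0 ≤ τ θ) (hΛ : ∀ θ, τ θ ≤ Λ) (hΛ0 : 0 ≤ Λ)
    {Q K V : Θ → W → Matrix (Fin D) (Fin d) ℝ} {Z : Θ → W → Matrix (Fin n) (Fin D) ℝ}
    (hQ : TameMatrix (fun _ => 1) Q) (hK : TameMatrix (fun _ => 1) K)
    (hV : TameMatrix (fun _ => 1) V) (hZ : TameMatrix τ Z) :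
    TameMatrix τ fun θ w => head (Q θ w) (K θ w) (V θ w) (Z θ w) := by
  have hproj : ∀ {A : Θ → W → Matrix (Fin D) (Fin d) ℝ}, TameMatrix (fun _ => 1) A →
      TameMatrix τ fun θ w => Z θ w * A θ w := fun hA => hZ.mul hA zero_le_one (by simp)
  have hKt : TameMatrix τ fun θ w => (Z θ w * K θ w)ᵀ := fun i j => hproj hK j i
  have hscore : TameMatrix (fun _ => 1)
      fun θ w => (1 / Real.sqrt d) • ((Z θ w * Q θ w) * (Z θ w * K θ w)ᵀ) :=
    ((hproj hQ).mul hKt (C := Λ * Λ) (by positivity) fun θ => by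
      rw [mul_one]; exact mul_le_mul (hΛ θ) (hΛ θ) (hτ θ) hΛ0).smul _
  exact hscore.softmax.mul (hproj hV) zero_le_one (by simp)

theorem tameMatrix_msa (hτ : ∀ θ, 0 ≤ τ θ) (hΛ : ∀ θ, τ θ ≤ Λ) (hΛ0 : 0 ≤ Λ)
    {ω : Θ → W → LayerEntry H d D D' → ℝ} (hω : ∀ j, Tame (fun _ => 1) fun θ w => ω θ w j)
    {Z : Θ → W → Matrix (Fin n) (Fin D) ℝ} (hZ : TameMatrix τ Z) :
    TameMatrix τ fun θ w => msa (LayerWeights.ofEntries (ω θ w)) (Z θ w) := by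
  refine TameMatrix.mul (s := τ) (t := fun _ => 1) (fun i c => ?_) (fun i j => hω _) zero_le_one
    (by simp)
  exact tameMatrix_head hτ hΛ hΛ0 (fun _ _ => hω _) (fun _ _ => hω _) (fun _ _ => hω _) hZ i c.2

theorem tameMatrix_ffn {act : ℝ → ℝ} (hact : ∃ K, LipschitzWith K act)
    (hact0 : Dominated τ (act 0)) {b₁ : Fin D' → ℝ} {b₂ : Fin D → ℝ}
    (hb₁ : ∀ j, Dominated τ (b₁ j)) (hb₂ : ∀ j, Dominated τ (b₂ j))
    {ω : Θ → W → LayerEntry H d D D' → ℝ} (hω : ∀ j, Tame (fun _ => 1) fun θ w => ω θ w j)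
    {Z : Θ → W → Matrix (Fin n) (Fin D) ℝ} (hZ : TameMatrix τ Z) :
    TameMatrix τ fun θ w => ffn act b₁ b₂ (LayerWeights.ofEntries (ω θ w)) (Z θ w) := by
  obtain ⟨K, hK⟩ := hact
  have hin : TameMatrix τ fun θ w => Z θ w * (LayerWeights.ofEntries (ω θ w)).Win :=
    hZ.mul (fun i j => hω _) zero_le_one (by simp)
  have hhid : TameMatrix τ fun θ w =>
      (Z θ w * (LayerWeights.ofEntries (ω θ w)).Win + Matrix.of fun _ j => b₁ j).map act :=
    fun i j => ((hin i j).add (Tame.const (hb₁ j))).comp_lipschitz hK hact0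
  have hout : TameMatrix τ fun θ w =>
      (Z θ w * (LayerWeights.ofEntries (ω θ w)).Win + Matrix.of fun _ j => b₁ j).map act *
        (LayerWeights.ofEntries (ω θ w)).Wout :=
    hhid.mul (fun i j => hω _) zero_le_one (by simp)
  exact hout.add fun i j => Tame.const (hb₂ j)

theorem tameMatrix_run (hτ : ∀ θ, 0 ≤ τ θ) (hΛ : ∀ θ, τ θ ≤ Λ) (hΛ0 : 0 ≤ Λ)
    (F : FrozenLayer n D D') {act : ℝ → ℝ} (hact : ∃ K, LipschitzWith K act)
    (hact0 : Dominated τ (act 0)) (hb₁ : ∀ j, Dominated τ (F.b₁ j))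
    (hb₂ : ∀ j, Dominated τ (F.b₂ j)) (h₁ : Dominated τ (F.msaPre 0))
    (h₂ : Dominated τ (F.msaPost 0)) (h₃ : Dominated τ (F.ffnPre 0))
    (h₄ : Dominated τ (F.ffnPost 0)) {ω : Θ → W → LayerEntry H d D D' → ℝ}
    (hω : ∀ j, Tame (fun _ => 1) fun θ w => ω θ w j)
    {Z : Θ → W → Matrix (Fin n) (Fin D) ℝ} (hZ : TameMatrix τ Z) :
    TameMatrix τ fun θ w => F.run act (LayerWeights.ofEntries (ω θ w)) (Z θ w) := by
  have hZ₁ : TameMatrix τ fun θ w => F.msaPost (F.skip • Z θ w +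
      msa (LayerWeights.ofEntries (ω θ w)) (F.msaPre (Z θ w))) :=
    ((hZ.smul F.skip).add
      (tameMatrix_msa hτ hΛ hΛ0 hω (hZ.comp_frobLipschitz F.msaPre_lip h₁))).comp_frobLipschitz
      F.msaPost_lip h₂
  exact ((hZ₁.smul F.skip).add (tameMatrix_ffn hact hact0 hb₁ hb₂ hω
    (hZ₁.comp_frobLipschitz F.ffnPre_lip h₃))).comp_frobLipschitz F.ffnPost_lip h₄

end Layers

/-! ### Lipschitz dependence of the whole Transformer. -/

section Evaluation

attribute [local instance] Matrix.frobeniusNormedAddCommGroup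

variable {p n L H d D D' q : ℕ}

/-- The output of a Transformer as a function of the entries of its weight matrices. -/
noncomputable def Transformer.evalEntries (M : Transformer p n L H d D D' q) (x : EuclideanSpace ℝ (Fin p))
    (ω : Fin L × LayerEntry H d D D' → ℝ) : EuclideanSpace ℝ (Fin q) :=
  M.out (Fin.foldl L
    (fun Z l => (M.layer l).run M.act (LayerWeights.ofEntries fun j => ω (l, j)) Z) (M.embed x))

theorem Transformer.eval_eq_evalEntries {P : ℕ} (M : Transformer p n L H d D D' q)
    (e : LayerEntry H d D D' ≃ Fin P) (x : EuclideanSpace ℝ (Fin p))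
    (V : Matrix (Fin L) (Fin P) ℝ) : M.eval e x V = M.evalEntries x fun j => V j.1 (e j.2) :=
  rfl

variable {Θ W : Type*} [PseudoMetricSpace W] {τ : Θ → ℝ} {Λ ρ : ℝ}

/-- Along tame inputs and weights, the output of a Transformer is Lipschitz at the input scale. -/
theorem Transformer.exists_lipschitz (M : Transformer p n L H d D D' q) (hρ : 0 < ρ)
    (hτ : ∀ θ, 0 ≤ τ θ) (hΛ : ∀ θ, τ θ ≤ Λ) (hΛ0 : 0 ≤ Λ) (hoff : ∀ θ, ρ ≤ τ θ ∨ M.OffsetFree)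
    {x : Θ → W → EuclideanSpace ℝ (Fin p)} (hx : Tame τ x)
    {ω : Θ → W → Fin L × LayerEntry H d D D' → ℝ}
    (hω : ∀ j, Tame (fun _ => 1) fun θ w => ω θ w j) :
    ∃ c : ℝ, 0 ≤ c ∧ ∀ θ w w', ‖M.evalEntries (x θ w) (ω θ w) - M.evalEntries (x θ w') (ω θ w')‖ ≤
      c * τ θ * dist w w' := by
  have hdom : ∀ {E : Type} [SeminormedAddCommGroup E] {v : E}, (M.OffsetFree → v = 0) →
      Dominated τ v := fun h => Dominated.of_le_or_eq_zero hρ hτ fun θ => (hoff θ).imp_right h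
  obtain ⟨Ke, hKe⟩ := M.embed_lip
  obtain ⟨Ko, hKo⟩ := M.out_lip
  have hfold := foldl_induction (Θ := Θ) (W := W) (TameMatrix τ)
    (fun l θ w Z => (M.layer l).run M.act (LayerWeights.ofEntries fun j => ω θ w (l, j)) Z)
    (fun l Φ hΦ => tameMatrix_run hτ hΛ hΛ0 (M.layer l) M.act_lip (hdom fun h => h.act)
      (fun j => hdom fun h => by rw [h.b₁]; rfl) (fun j => hdom fun h => by rw [h.b₂]; rfl)
      (hdom fun h => h.msaPre l) (hdom fun h => h.msaPost l) (hdom fun h => h.ffnPre l)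
      (hdom fun h => h.ffnPost l) (fun j => hω (l, j)) hΦ)
    (TameMatrix.of_tame (hx.comp_lipschitz hKe (hdom fun h => h.embed)))
  obtain ⟨c, hc, hfold⟩ := hfold.tame
  refine ⟨Ko * c, by positivity, fun θ w w' => (hKo.norm_sub_le _ _).trans ?_⟩
  rw [mul_assoc, mul_assoc, ← mul_assoc c]
  exact mul_le_mul_of_nonneg_left ((hfold θ).2 w w') Ko.coe_nonneg

theorem tame_coe_closedBall {E : Type*} [SeminormedAddCommGroup E] {r : ℝ} (hr : 0 ≤ r) :
    Tame (fun _ : Θ => 1) fun _ (w : Metric.closedBall (0 : E) r) => (w : E) := by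
  refine ⟨r + 1, by positivity, fun θ => ⟨fun w => ?_, fun w w' => ?_⟩⟩
  · linarith [mem_closedBall_zero_iff.1 w.2]
  · rw [← dist_eq_norm, mul_one, ← Subtype.dist_eq]
    exact le_mul_of_one_le_left dist_nonneg (by linarith)

/-- Local Lipschitz continuity from the same calculus, with the pair (input, weights) varying in a
ball and the scale constantly `1`, so that offsets are dominated with `ρ = 1`. -/
theorem Transformer.continuous_evalEntries (M : Transformer p n L H d D D' q) :
    Continuous fun a : EuclideanSpace ℝ (Fin p) × (Fin L × LayerEntry H d D D' → ℝ) =>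
      M.evalEntries a.1 a.2 := by
  refine continuous_iff_continuousAt.2 fun a₀ => ?_
  set r := ‖a₀‖ + 1
  have hr : 0 ≤ r := by positivity
  have hball := tame_coe_closedBall (Θ := Unit)
    (E := EuclideanSpace ℝ (Fin p) × (Fin L × LayerEntry H d D D' → ℝ)) hr
  have hx : Tame (fun _ : Unit => 1) fun _ (w : Metric.closedBall
      (0 : EuclideanSpace ℝ (Fin p) × (Fin L × LayerEntry H d D D' → ℝ)) r) => w.1.1 :=
    hball.comp_lipschitz LipschitzWith.prod_fst ⟨0, le_rfl, fun _ => by simp⟩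
  have hω : ∀ j, Tame (fun _ : Unit => 1) fun _ (w : Metric.closedBall
      (0 : EuclideanSpace ℝ (Fin p) × (Fin L × LayerEntry H d D D' → ℝ)) r) => w.1.2 j := fun j =>
    (hball.comp_lipschitz LipschitzWith.prod_snd ⟨0, le_rfl, fun _ => by simp⟩).comp_lipschitz
      (LipschitzWith.eval j) ⟨0, le_rfl, fun _ => by simp⟩
  obtain ⟨c, hc, h⟩ := M.exists_lipschitz (ρ := 1) (Λ := 1) one_pos (fun _ => zero_le_one)
    (fun _ => le_rfl) zero_le_one (fun _ => Or.inl le_rfl) hx hω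
  have hlip : LipschitzOnWith c.toNNReal
      (fun a : EuclideanSpace ℝ (Fin p) × (Fin L × LayerEntry H d D D' → ℝ) =>
        M.evalEntries a.1 a.2) (Metric.closedBall 0 r) :=
    LipschitzOnWith.of_dist_le_mul fun a ha b hb => by
      have := h () ⟨a, ha⟩ ⟨b, hb⟩
      rw [mul_one] at this
      rw [dist_eq_norm, Real.coe_toNNReal c hc]
      exact this
  refine hlip.continuousOn.continuousAt (Metric.closedBall_mem_nhds_of_mem ?_)
  rw [mem_ball_zero_iff]
  exact lt_add_one _

/-- Lipschitz dependence of a Transformer on its weights, linear in the size of the input. -/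
theorem Transformer.exists_lipschitz_weights (M : Transformer p n L H d D D' q) (hρ : 0 < ρ)
    (hΛ : 0 < Λ) : ∃ c : ℝ, 0 ≤ c ∧ ∀ R, R ≤ Λ → (ρ ≤ R ∨ M.OffsetFree) → ∀ x, ‖x‖ ≤ R →
      ∀ w w' : Fin L × LayerEntry H d D D' → ℝ, ‖w‖ ≤ Λ → ‖w'‖ ≤ Λ →
        ‖M.evalEntries x w - M.evalEntries x w'‖ ≤ c * R * ‖w - w'‖ := by
  -- Radius and input are packed into the parameter `θ`, so that one constant serves all of them.
  let Ξ := {θ : ℝ × EuclideanSpace ℝ (Fin p) //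
    ‖θ.2‖ ≤ θ.1 ∧ θ.1 ≤ Λ ∧ (ρ ≤ θ.1 ∨ M.OffsetFree)}
  have hx : Tame (fun θ : Ξ => θ.1.1) fun θ (_ : Metric.closedBall
      (0 : Fin L × LayerEntry H d D D' → ℝ) Λ) => θ.1.2 :=
    ⟨1, zero_le_one, fun θ => ⟨fun _ => by rw [one_mul]; exact θ.2.1, fun w w' => by
      rw [sub_self, norm_zero, one_mul]
      exact mul_nonneg ((norm_nonneg _).trans θ.2.1) dist_nonneg⟩⟩
  have hω : ∀ j, Tame (fun _ : Ξ => 1) fun _ (w : Metric.closedBall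
      (0 : Fin L × LayerEntry H d D D' → ℝ) Λ) => w.1 j := fun j =>
    (tame_coe_closedBall hΛ.le).comp_lipschitz (g := fun a : Fin L × LayerEntry H d D D' → ℝ => a j)
       (LipschitzWith.eval j)
      ⟨0, le_rfl, fun _ => by simp⟩
  obtain ⟨c, hc, h⟩ := M.exists_lipschitz hρ (fun θ : Ξ => (norm_nonneg _).trans θ.2.1)
    (fun θ => θ.2.2.1) hΛ.le (fun θ => θ.2.2.2) hx hω
  refine ⟨c, hc, fun R hR hoff x hxR w w' hw hw' => ?_⟩
  have := h ⟨(R, x), hxR, hR, hoff⟩ ⟨w, mem_closedBall_zero_iff.2 hw⟩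
    ⟨w', mem_closedBall_zero_iff.2 hw'⟩
  rwa [Subtype.dist_eq, dist_eq_norm] at this

end Evaluation

/-! ### Rademacher complexity of Transformers with weights `T ⊗ S`. -/

section Complexity

/-- Each entry is an inner product over the index `i` of one template entry and one scaler entry, so
Cauchy–Schwarz applies. This gives the cube for chaining. -/
theorem abs_kron_le {N L A B : ℕ} (T : Fin N → Matrix (Fin 1) (Fin A) ℝ)
    (S : Fin N → Matrix (Fin L) (Fin B) ℝ) (l : Fin L) (j : Fin (A * B)) :
    |kron T S l j| ≤ famNorm T * famNorm S := by
  have hentry : ∀ {a b : ℕ} (M : Fin N → Matrix (Fin a) (Fin b) ℝ) (x : Fin a) (y : Fin b),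
      ∑ i, M i x y ^ 2 ≤ ∑ i, ∑ x, ∑ y, M i x y ^ 2 := fun M x y =>
    Finset.sum_le_sum fun i _ =>
      (Finset.single_le_sum (f := fun y => M i x y ^ 2) (fun _ _ => sq_nonneg _)
        (Finset.mem_univ y)).trans
        (Finset.single_le_sum (f := fun x => ∑ y, M i x y ^ 2)
          (fun _ _ => Finset.sum_nonneg fun _ _ => sq_nonneg _) (Finset.mem_univ x))
  rw [kron_apply, famNorm, famNorm]
  refine (Finset.abs_sum_le_sum_abs _ _).trans ?_
  simp only [abs_mul]
  refine (Real.sum_mul_le_sqrt_mul_sqrt _ _ _).trans ?_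
  simp only [sq_abs]
  exact mul_le_mul (Real.sqrt_le_sqrt (hentry T 0 _)) (Real.sqrt_le_sqrt (hentry S l _))
    (Real.sqrt_nonneg _) (Real.sqrt_nonneg _)

variable {p n L H d D D' q : ℕ}

theorem Transformer.measurable_eval {P : ℕ} (M : Transformer p n L H d D D' q)
    (e : LayerEntry H d D D' ≃ Fin P) (V : Matrix (Fin L) (Fin P) ℝ) :
    Measurable fun x => M.eval e x V := by
  simp only [M.eval_eq_evalEntries]
  have h : Continuous fun x : EuclideanSpace ℝ (Fin p) =>
      (x, fun j : Fin L × LayerEntry H d D D' => V j.1 (e j.2)) := by fun_prop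
  exact (M.continuous_evalEntries.comp h).measurable

theorem Transformer.continuous_eval {P : ℕ} (M : Transformer p n L H d D D' q)
    (e : LayerEntry H d D D' ≃ Fin P) (x : EuclideanSpace ℝ (Fin p)) :
    Continuous (M.eval e x) := by
  have heq : M.eval e x = fun V => M.evalEntries x fun j => V j.1 (e j.2) :=
    funext (M.eval_eq_evalEntries e x)
  rw [heq]
  have h₁ : Continuous fun V : Matrix (Fin L) (Fin P) ℝ =>
      fun j : Fin L × LayerEntry H d D D' => V j.1 (e j.2) :=
    continuous_pi fun j => (continuous_apply (e j.2)).comp (continuous_apply j.1)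
  have h := M.continuous_evalEntries.comp ((continuous_const (y := x)).prodMk h₁)
  exact h

/-- The Rademacher complexity of the Transformers with weights `T ⊗ S`. -/
theorem Transformer.two_mul_rademacher_le (M : Transformer p n L H d D D' q) {c R Λ : ℝ}
    (hc : 0 ≤ c) {Y : Type*} {N A B m : ℕ} (hm : 0 < m)
    (z : Fin m → EuclideanSpace ℝ (Fin p) × Y)
    (hM : ∀ i, ∀ w w' : Fin L × LayerEntry H d D D' → ℝ, ‖w‖ ≤ Λ → ‖w'‖ ≤ Λ →
      ‖M.evalEntries (z i).1 w - M.evalEntries (z i).1 w'‖ ≤ c * R * ‖w - w'‖) (hR : 0 ≤ R)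
    (e : LayerEntry H d D D' ≃ Fin (A * B)) (T : Fin N → Matrix (Fin 1) (Fin A) ℝ) {C : ℝ}
    (hC : 0 ≤ C) (hT : C * famNorm T ≤ Λ) (loss : EuclideanSpace ℝ (Fin q) → Y → ℝ) {K : ℝ}
    (hK : 0 ≤ K) (hloss : ∀ y u v, |loss u y - loss v y| ≤ K * ‖u - v‖) :
    2 * rademacher (hypothesisSpace (M.eval e) T C) loss z ≤
      96 * (Fintype.card (Fin L × LayerEntry H d D D') + 1) * c *
        (K * R * C * famNorm T / Real.sqrt m) := by
  have hm' : (0 : ℝ) < m := by exact_mod_cast hm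
  have hT0 : 0 ≤ famNorm T := Real.sqrt_nonneg _
  have : Nonempty (hypothesisSpace (M.eval e) T C) :=
    ⟨⟨_, 0, by rw [famNorm_zero]; exact hC, rfl⟩⟩
  -- One scaler per hypothesis turns the supremum over functions into one indexed by points of the
  -- cube.
  choose S hS hf using fun h : hypothesisSpace (M.eval e) T C => h.2
  have hw : ∀ h, ‖fun j : Fin L × LayerEntry H d D D' => kron T (S h) j.1 (e j.2)‖ ≤
      C * famNorm T := fun h => by
    refine (pi_norm_le_iff_of_nonneg (by positivity)).2 fun j => (abs_kron_le _ _ _ _).trans ?_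
    rw [mul_comm]
    exact mul_le_mul_of_nonneg_right (hS h) hT0
  have hchain := average_signs_iSup_lipschitz_le (m := m) (r := C * famNorm T) (A := K * (c * R))
    (by positivity) (by positivity) (fun w k => loss (M.evalEntries (z k).1 w) (z k).2)
    (fun w w' h h' k => (hloss _ _ _).trans (by
      rw [mul_assoc]
      exact mul_le_mul_of_nonneg_left (hM k w w' (h.trans hT) (h'.trans hT)) hK)) _ hw
  have hrad : rademacher (hypothesisSpace (M.eval e) T C) loss z =
      (1 / (m : ℝ)) * ((1 / (2 : ℝ) ^ m) * ∑ σ : Fin m → ℤˣ,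
        ⨆ h : hypothesisSpace (M.eval e) T C, ∑ k, ((σ k : ℤ) : ℝ) *
          loss (M.evalEntries (z k).1 fun j => kron T (S h) j.1 (e j.2)) (z k).2) := by
    unfold rademacher
    rw [mul_left_comm, Finset.mul_sum (a := 1 / (m : ℝ))]
    congr 1
    refine Finset.sum_congr rfl fun σ _ => ?_
    rw [Real.mul_iSup_of_nonneg (by positivity)]
    congr 1
    ext h
    rw [hf h]
    rfl
  rw [hrad]
  refine (mul_le_mul_of_nonneg_left (mul_le_mul_of_nonneg_left hchain (by positivity))
    zero_le_two).trans (le_of_eq ?_)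
  have hs : 1 / (m : ℝ) * Real.sqrt m = 1 / Real.sqrt m := by
    rw [one_div_mul_eq_div, Real.sqrt_div_self']
  linear_combination (96 * (Fintype.card (Fin L × LayerEntry H d D D') + 1) *
    (K * (c * R) * (C * famNorm T))) * hs

end Complexity

end WeiT

/-! ### The generalization theorem. -/

theorem mainTheorem3 :
    -- the uniform bound, for every network that is continuous in its weights
    (∀ {X Y : Type*} [MeasurableSpace X] [MeasurableSpace Y] (N L r₁ r₂ B q m : ℕ) (_ : 0 < m)
      (f : X → Matrix (Fin L) (Fin (r₁ * r₂ * B)) ℝ → EuclideanSpace ℝ (Fin q))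
      (_ : ∀ W, Measurable fun x => f x W) (_ : ∀ x, Continuous (f x))
      (T : Fin N → Matrix (Fin 1) (Fin (r₁ * r₂)) ℝ) (C_S : ℝ) (_ : 0 ≤ C_S)
      (loss : EuclideanSpace ℝ (Fin q) → Y → ℝ) (_ : Measurable (Function.uncurry loss))
      (_ : ∀ y, Continuous fun u => loss u y)
      (μ : Measure (X × Y)) [IsProbabilityMeasure μ]
      (_ : ∀ᵐ z ∂μ, ∀ h ∈ WeiT.hypothesisSpace f T C_S, loss (h z.1) z.2 ∈ Set.Icc (0 : ℝ) 1)
      (δ : ℝ) (_ : 0 < δ) (_ : δ < 1),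
      1 - δ ≤ (Measure.pi fun _ : Fin m => μ).real
        {z | ∀ h ∈ WeiT.hypothesisSpace f T C_S,
          WeiT.risk μ loss h ≤ WeiT.empRisk z loss h
            + 2 * WeiT.rademacher (WeiT.hypothesisSpace f T C_S) loss z
            + 3 * Real.sqrt (Real.log (2 / δ) / (2 * m))}) ∧
    -- the complexity term for Transformers
    (∀ (p n L H d D D' q : ℕ) (M : WeiT.Transformer p n L H d D D' q)
      (ρ Λ : ℝ) (_ : 0 < ρ) (_ : 0 < Λ), ∃ K : ℝ, 0 < K ∧
      ∀ {Y : Type*} [MeasurableSpace Y] (N r₁ r₂ B m : ℕ) (_ : 0 < m)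
        (e : WeiT.LayerEntry H d D D' ≃ Fin (r₁ * r₂ * B))
        (T : Fin N → Matrix (Fin 1) (Fin (r₁ * r₂)) ℝ) (C_S : ℝ) (_ : 0 ≤ C_S)
        (_ : C_S * WeiT.famNorm T ≤ Λ)
        (R : ℝ) (_ : R ≤ Λ) (_ : ρ ≤ R ∨ M.OffsetFree)
        (loss : EuclideanSpace ℝ (Fin q) → Y → ℝ) (_ : Measurable (Function.uncurry loss))
        (L_loss : ℝ) (_ : 0 ≤ L_loss) (_ : ∀ y u v, |loss u y - loss v y| ≤ L_loss * ‖u - v‖),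
        (∀ z : Fin m → EuclideanSpace ℝ (Fin p) × Y, (∀ i, ‖(z i).1‖ ≤ R) →
          2 * WeiT.rademacher (WeiT.hypothesisSpace (M.eval e) T C_S) loss z
            ≤ K * (L_loss * R * C_S * WeiT.famNorm T / Real.sqrt m)) ∧
        ∀ (μ : Measure (EuclideanSpace ℝ (Fin p) × Y)) [IsProbabilityMeasure μ]
          (_ : ∀ᵐ z ∂μ, ‖z.1‖ ≤ R)
          (_ : ∀ᵐ z ∂μ, ∀ h ∈ WeiT.hypothesisSpace (M.eval e) T C_S,
            loss (h z.1) z.2 ∈ Set.Icc (0 : ℝ) 1)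
          (δ : ℝ) (_ : 0 < δ) (_ : δ < 1),
          1 - δ ≤ (Measure.pi fun _ : Fin m => μ).real
            {z | ∀ h ∈ WeiT.hypothesisSpace (M.eval e) T C_S,
              WeiT.risk μ loss h ≤ WeiT.empRisk z loss h
                + K * (L_loss * R * C_S * WeiT.famNorm T / Real.sqrt m)
                + 3 * Real.sqrt (Real.log (2 / δ) / (2 * m))}) := by
  refine ⟨?_, ?_⟩
  · intro X Y _ _ N L r₁ r₂ B q m hm f hfm hfc T C_S hC loss hloss hlc μ _ hμ δ hδ hδ'
    exact WeiT.generalization_bound hm f hfm hfc T hC loss hloss hlc μ hμ hδ hδ'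
  · intro p n L H d D D' q M ρ Λ hρ hΛ
    obtain ⟨c, hc, hlip⟩ := M.exists_lipschitz_weights hρ hΛ
    -- Twice the chaining constant `48`, times the Lipschitz constant `c`; the `+ 1` secures
    -- positivity when `c = 0`.
    refine ⟨96 * (Fintype.card (Fin L × WeiT.LayerEntry H d D D') + 1) * c + 1, by positivity, ?_⟩
    intro Y _ N r₁ r₂ B m hm e T C_S hC hT R hR hoff loss hloss L_loss hL hll
    have hrad : ∀ z : Fin m → EuclideanSpace ℝ (Fin p) × Y, (∀ i, ‖(z i).1‖ ≤ R) →
        2 * WeiT.rademacher (WeiT.hypothesisSpace (M.eval e) T C_S) loss z ≤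
          (96 * (Fintype.card (Fin L × WeiT.LayerEntry H d D D') + 1) * c + 1) *
            (L_loss * R * C_S * WeiT.famNorm T / Real.sqrt m) := fun z hz => by
      have hR0 : 0 ≤ R := (norm_nonneg _).trans (hz ⟨0, hm⟩)
      have hT0 : 0 ≤ WeiT.famNorm T := Real.sqrt_nonneg _
      refine (M.two_mul_rademacher_le hc hm z (fun i => hlip R hR hoff _ (hz i)) hR0 e T hC hT loss
        hL hll).trans (mul_le_mul_of_nonneg_right (by linarith) (by positivity))
    refine ⟨hrad, fun μ _ hμR hμ δ hδ hδ' => ?_⟩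
    have hlc : ∀ y, Continuous fun u => loss u y := fun y =>
      (LipschitzWith.of_dist_le_mul (K := L_loss.toNNReal) fun u v => by
        rw [Real.dist_eq, dist_eq_norm, Real.coe_toNNReal _ hL]
        exact hll y u v).continuous
    refine (WeiT.generalization_bound hm (M.eval e) (M.measurable_eval e) (M.continuous_eval e) T
      hC loss hloss hlc μ hμ hδ hδ').trans
      (ENNReal.toReal_mono (measure_ne_top _ _) (measure_mono_ae ?_))
    have hae : ∀ᵐ z ∂(Measure.pi fun _ : Fin m => μ), ∀ k, ‖(z k).1‖ ≤ R :=
      ae_all_iff.2 fun k =>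
        (measurePreserving_eval (fun _ : Fin m => μ) k).quasiMeasurePreserving.ae hμR
    filter_upwards [hae] with z hz hbound h hh
    linarith [hbound h hh, hrad z hz]
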